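/- For $n\in\mathbb{Z}$ and $\alpha\in\mathbb{R}$ let $|\beta|=(2|\alpha n|)^{1/3}$, and for functions on $[1,\infty)$ let $$H_n=-\frac{d^2}{dr^2}-\frac1r\frac{d}{dr}+\frac{n^2}{r^2},\qquad A_n=H_n-i\alpha n\Big(1-\frac1{r^2}\Big).$$ For $g:[1,\infty)\to\mathbb{C}$ put $\|g\|_{L^2(\Omega)}=\big(2\pi\int_1^\infty|g(r)|^2\,r\,dr\big)^{1/2}$ (that is, $\Omega=\{x\in\mathbb{R}^2:|x|>1\}$ and $g$ is regarded as a function of $r=|x|$). Let $\mathrm{Ai}$ be the (entire) Airy function, and for $\alpha n\neq0$ let $c=\frac{\sqrt3-i}{2}$ if $\alpha n>0$, $c=\frac{\sqrt3+i}{2}$ if $\alpha n<0$, and $$\widetilde G_{n,\alpha}(\rho)=\mathrm{Ai}\Big(c\big(\rho+\tfrac{in|\beta|}{2\alpha}\big)\Big),\qquad G^{0}_{n,\alpha}(\rho)=-\int_\rho^\infty e^{-\frac{|n|}{|\beta|}(\rho-\tau)}\int_\tau^\infty e^{-\frac{|n|}{|\beta|}(\sigma-\tau)}\,\widetilde G_{n,\alpha}(\sigma)\,d\sigma\,d\tau,$$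 with the normalising factor $C_{0,n,\alpha}=1/G^0_{n,\alpha}(0)$ if $|G^0_{n,\alpha}(0)|\ge1$ and $C_{0,n,\alpha}=1$ otherwise. **Proposition.** There exist constants $\kappa\in(0,1)$ and $C,B,R,M>0$ such that for all $n\in\mathbb{Z}$, $\alpha\in\mathbb{R}$ with $|n|\le\kappa|\alpha|^{1/2}$ and $|\beta|\ge B$ there are smooth functions $\varphi_{n,\mathrm{BL}},g_{n,\mathrm{BL}}:[1,\infty)\to\mathbb{C}$ and a smooth function $G_{n,\alpha}:[0,\infty)\to\mathbb{C}$ with the following properties. 1. On $[1,\infty)$, $A_nH_n\varphi_{n,\mathrm{BL}}=\frac1r\frac{d}{dr}(r\,g_{n,\mathrm{BL}})$, with $\|g_{n,\mathrm{BL}}\|_{L^2(\Omega)}\le C|\beta|^{3/2}$ (in particular finite) and $|\varphi_{n,\mathrm{BL}}(1)|\le1$. 2. $\big|\varphi_{n,\mathrm{BL}}'(1)+|n|\,\varphi_{n,\mathrm{BL}}(1)\big|\ge\frac{\kappa}{2}|\beta|$. 3. $\varphi_{n,\mathrm{BL}}(r)=G_{n,\alpha}(|\beta|(r-1))$ for $r\ge1$,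 where $G_{n,\alpha}=C_{0,n,\alpha}G^0_{n,\alpha}$ on $[0,\infty)$. 4. $G_{n,\alpha}$ decays exponentially, uniformly in $n$ and $\alpha$: $e^{\rho}\,\big|\frac{d^kG_{n,\alpha}}{d\rho^k}(\rho)\big|\le M$ for all $\rho\ge R$ and $k=0,1,2,3$. -/

import Mathlib

open Set MeasureTheory
open scoped ContDiff

noncomputable section

namespace BoundaryLayer

/-- The modulus `|β| = (2|αn|)^{1/3}` of `β = (-2iαn)^{1/3}`. -/
def betaAbs (n : ℤ) (α : ℝ) : ℝ := (2 * |α * (n : ℝ)|) ^ ((1 : ℝ) / 3)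

/-- The direction of `β = (-2iαn)^{1/3}`: it is `c₋ = (√3 - i)/2` if `αn > 0`
and `c₊ = (√3 + i)/2` if `αn < 0`. -/
def betaDir (n : ℤ) (α : ℝ) : ℂ :=
  if 0 < α * (n : ℝ) then ((√3 : ℝ) - Complex.I) / 2 else ((√3 : ℝ) + Complex.I) / 2

/-- `H_n f = -f'' - f'/r + n² f / r²`, acting on functions on `[1, ∞)`
(derivatives at `r = 1` are one-sided). -/
def opH (n : ℤ) (f : ℝ → ℂ) (r : ℝ) : ℂ :=
  -derivWithin (derivWithin f (Ici 1)) (Ici 1) r - (1 / (r : ℂ)) * derivWithin f (Ici 1) r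
    + ((n : ℂ) ^ 2 / (r : ℂ) ^ 2) * f r

/-- `A_n f = H_n f - iαn (1 - 1/r²) f`, acting on functions on `[1, ∞)`. -/
def opA (n : ℤ) (α : ℝ) (f : ℝ → ℂ) (r : ℝ) : ℂ :=
  opH n f r - Complex.I * (α : ℂ) * (n : ℂ) * (1 - 1 / (r : ℂ) ^ 2) * f r

/-- Membership in `L²(Ω)`, `Ω = {x ∈ ℝ² : |x| > 1}`, of a function of `r = |x|`. -/
def MemL2 (g : ℝ → ℂ) : Prop :=
  AEStronglyMeasurable g (volume.restrict (Ioi (1 : ℝ))) ∧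
    IntegrableOn (fun r : ℝ => ‖g r‖ ^ 2 * r) (Ioi 1)

/-- The `L²(Ω)` norm `(2π ∫₁^∞ |g(r)|² r dr)^{1/2}` of a function of `r = |x|`. -/
def normL2 (g : ℝ → ℂ) : ℝ :=
  √(2 * Real.pi * ∫ r in Ioi (1 : ℝ), ‖g r‖ ^ 2 * r)

/-- The entire Airy function
`Ai(z) = (2π)⁻¹ ∫ exp(i ξ³/3 + i z ξ) dξ`, the inverse Fourier transform of `exp(i ξ³/3)`,
with the line of integration moved from `ℝ` to `ℝ + i`, where the integrand has Gaussian decay,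
so that the integral converges absolutely for every complex `z`. -/
def airy (z : ℂ) : ℂ :=
  (1 / (2 * (Real.pi : ℂ))) * ∫ x : ℝ,
    Complex.exp (Complex.I * ((x : ℂ) + Complex.I) ^ 3 / 3
      + Complex.I * z * ((x : ℂ) + Complex.I))

/-- `ρ ↦ Ai(c (ρ + i n |β| / (2α)))`, where `β = c |β|`. -/
def airyLayer (n : ℤ) (α : ℝ) (ρ : ℝ) : ℂ :=
  airy (betaDir n α *
    ((ρ : ℂ) + Complex.I * (n : ℂ) * (betaAbs n α : ℂ) / (2 * (α : ℂ))))

/-- `ρ ↦ -∫_ρ^∞ e^{-(|n|/|β|)(ρ-τ)} ∫_τ^∞ e^{-(|n|/|β|)(σ-τ)} Ai(c (σ + i n |β| / (2α))) dσ dτ`. -/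
def airyProfile (n : ℤ) (α : ℝ) (ρ : ℝ) : ℂ :=
  -∫ τ in Ioi ρ, (Real.exp (-(|(n : ℝ)| / betaAbs n α) * (ρ - τ)) : ℂ) *
    ∫ σ in Ioi τ, (Real.exp (-(|(n : ℝ)| / betaAbs n α) * (σ - τ)) : ℂ) * airyLayer n α σ

open scoped Classical in
/-- The normalising factor: the inverse of the boundary value of the profile if that value has
modulus at least one, and `1` otherwise. -/
def normFactor (n : ℤ) (α : ℝ) : ℂ :=
  if 1 ≤ ‖airyProfile n α 0‖ then 1 / airyProfile n α 0 else 1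

end BoundaryLayer

end

/-!
With `s = ±1` the sign of `αn` and `δ = |n| / |β|`, the argument of the Airy function is
`c (ρ + i s δ²)` with `c³ = -s i`, so that the profile depends on `n` and `α` only through `s` and
`δ`. The condition `|n| ≤ κ |α|^{1/2}` says that `δ` is small (`abs_div_betaAbs_le`), and all bounds
have to be uniform for `δ ∈ [0, 1]`.

*The layer.* `W(ρ) = Ai(c (ρ + i s δ²))` solves `-W'' + δ² W - i s ρ W = 0`, and two exponentially
weighted tail integrals invert `-∂² + δ²`: they give `F` with `F' = δ F - W` and `G` with
`G' = F - δ G`. Moving the line of integration in the Airy integral to the height `√(ρ + 1)` gives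
`|W|, |W'| ≤ K exp(-4ρ)` (`norm_airyPrim_le_of_nearRay`, and Cauchy's estimate for derivatives),
and `F`, `G` inherit the bound (`ExpBounded.expTail`). These facts are collected in `LayerSystem`.

*Nondegeneracy.* For `φ(r) = G(|β|(r - 1))` one has `φ'(1) + |n| φ(1) = |β| F(0)`. At `δ = 0`,
rotating the ray of integration gives `c F(0) = ∫₀^∞ Ai`, which is nonzero because `Ai` has no zero
on `[0, ∞)`: `(Ai Ai')' = Ai'² + t Ai² ≥ 0` there, and `Ai` does not vanish identically by Fourier
inversion (`airyPrim_zero_ne_zero`). Continuity in `δ` then bounds `|F(0)|` from below for small `δ`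
(`exists_le_norm_expTail_layer`).

*The equation.* `H_n φ = |β|² W + |β| h₁`, where `h₁` (`corr`) and `|β|⁻¹ h₁'` are bounded by a
multiple of `exp(-2ρ)`. By the equation for `W` the terms of order `|β|⁴` in `A_n H_n φ` cancel, and
`r A_n H_n φ = (-|β| r h₁')' + k` with a remainder `k` (`residual`) of size `|β|³ exp(-2ρ)`. Hence
`g = -|β| h₁' - r⁻¹ ∫_r^∞ k` (`forcing`) has size `|β|² exp(-2ρ)`, which is `O(|β|^{3/2})` in `L²`.
-/

namespace BoundaryLayer

open Filter Topology

/-! ### The Airy integral -/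

/-- The integrand `exp(iξ³/3 + izξ)` of the Airy integral. -/
noncomputable def airyKernel (z ξ : ℂ) : ℂ :=
  Complex.exp (Complex.I * ξ ^ 3 / 3 + Complex.I * z * ξ)

/-- The primitive `P(z) = (2π)⁻¹ ∫ exp(iξ³/3 + izξ) / (iξ) dξ`, over the line `ℝ + i`, of the
Airy function. It is the primitive that vanishes at `+∞`. -/
noncomputable def airyPrim (z : ℂ) : ℂ :=
  (1 / (2 * (Real.pi : ℂ))) * ∫ x : ℝ,
    1 / (Complex.I * ((x : ℂ) + Complex.I)) * airyKernel z ((x : ℂ) + Complex.I)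

/-- The derivative of the Airy function, as an integral over the line `ℝ + i`. -/
noncomputable def airyDeriv (z : ℂ) : ℂ :=
  (1 / (2 * (Real.pi : ℂ))) * ∫ x : ℝ,
    Complex.I * ((x : ℂ) + Complex.I) * airyKernel z ((x : ℂ) + Complex.I)

lemma norm_airyKernel (z : ℂ) (x y : ℝ) :
    ‖airyKernel z ((x : ℂ) + (y : ℂ) * Complex.I)‖ =
      Real.exp (y ^ 3 / 3 - y * x ^ 2 - z.re * y - z.im * x) := by
  have h3 : (((x : ℂ) + (y : ℂ) * Complex.I)) ^ 3 =
      ((x ^ 3 - 3 * x * y ^ 2 : ℝ) : ℂ) + ((3 * x ^ 2 * y - y ^ 3 : ℝ) : ℂ) * Complex.I := by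
    push_cast
    linear_combination (3 * x * y ^ 2 + y ^ 3 * Complex.I : ℂ) * Complex.I_sq
  have h4 : Complex.I * (((x : ℂ) + (y : ℂ) * Complex.I)) ^ 3 / 3 =
      ((-(3 * x ^ 2 * y - y ^ 3) / 3 : ℝ) : ℂ) + (((x ^ 3 - 3 * x * y ^ 2) / 3 : ℝ) : ℂ) *
        Complex.I := by
    rw [h3]
    push_cast
    linear_combination ((3 * x ^ 2 * y - y ^ 3) / 3 : ℂ) * Complex.I_sq
  rw [airyKernel, Complex.norm_exp, h4]
  congr 1
  simp only [Complex.add_re, Complex.mul_re, Complex.mul_im, Complex.add_im, Complex.ofReal_re,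
    Complex.ofReal_im, Complex.I_re, Complex.I_im]
  ring

lemma norm_airyKernel_I (z : ℂ) (x : ℝ) :
    ‖airyKernel z ((x : ℂ) + Complex.I)‖ =
      Real.exp (1 / 3 - x ^ 2 - z.re - z.im * x) := by
  have := norm_airyKernel z x 1
  simpa using this

lemma norm_add_I_sq (x : ℝ) : ‖(x : ℂ) + Complex.I‖ ^ 2 = 1 + x ^ 2 := by
  rw [← Complex.normSq_eq_norm_sq, Complex.normSq_apply]
  simp
  ring

lemma one_le_norm_add_I (x : ℝ) : 1 ≤ ‖(x : ℂ) + Complex.I‖ := by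
  have := norm_add_I_sq x
  nlinarith [norm_nonneg ((x : ℂ) + Complex.I), sq_nonneg x]

lemma add_I_ne_zero (x : ℝ) : (x : ℂ) + Complex.I ≠ 0 := by
  have := one_le_norm_add_I x
  intro h
  rw [h, norm_zero] at this
  linarith

/-- Gaussian decay of the Airy integrand along `ℝ + i`, locally uniform in `z`, with room for a
quadratic factor. -/
lemma norm_sq_mul_norm_airyKernel_le {z : ℂ} {A : ℝ} (hr : |z.re| ≤ A) (hi : |z.im| ≤ A) (x : ℝ) :
    ‖(x : ℂ) + Complex.I‖ ^ 2 * ‖airyKernel z ((x : ℂ) + Complex.I)‖ ≤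
      4 * Real.exp (1 / 3 + A + A ^ 2 / 2) * Real.exp (-(1 / 4) * x ^ 2) := by
  rw [norm_add_I_sq, norm_airyKernel_I]
  have hA : z.im ^ 2 ≤ A ^ 2 := sq_le_sq' (by linarith [(abs_le.1 hi).1]) (abs_le.1 hi).2
  have h1 : 1 + x ^ 2 ≤ 4 * Real.exp (x ^ 2 / 4) := by
    nlinarith [Real.add_one_le_exp (x ^ 2 / 4)]
  have h2 : 1 / 3 - x ^ 2 - z.re - z.im * x ≤ (1 / 3 + A + A ^ 2 / 2) + -(1 / 2) * x ^ 2 := by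
    nlinarith [sq_nonneg (z.im + x), (abs_le.1 hr).1]
  calc (1 + x ^ 2) * Real.exp (1 / 3 - x ^ 2 - z.re - z.im * x)
      ≤ (4 * Real.exp (x ^ 2 / 4)) * Real.exp ((1 / 3 + A + A ^ 2 / 2) + -(1 / 2) * x ^ 2) := by
        gcongr
    _ = 4 * Real.exp (1 / 3 + A + A ^ 2 / 2) * Real.exp (-(1 / 4) * x ^ 2) := by
        rw [mul_assoc, mul_assoc, ← Real.exp_add, ← Real.exp_add]
        congr 2
        ring

lemma continuous_airyKernel_I (z : ℂ) :
    Continuous fun x : ℝ => airyKernel z ((x : ℂ) + Complex.I) := by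
  unfold airyKernel
  fun_prop

lemma integrable_mul_airyKernel {w : ℝ → ℂ} (hw : Continuous w)
    (hb : ∀ x : ℝ, ‖w x‖ ≤ ‖(x : ℂ) + Complex.I‖ ^ 2) (z : ℂ) :
    Integrable fun x : ℝ => w x * airyKernel z ((x : ℂ) + Complex.I) := by
  set A := max |z.re| |z.im|
  refine ((integrable_exp_neg_mul_sq (b := 1 / 4) (by norm_num)).const_mul
    (4 * Real.exp (1 / 3 + A + A ^ 2 / 2))).mono'
    (hw.mul (continuous_airyKernel_I z)).aestronglyMeasurable (ae_of_all _ fun x => ?_)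
  rw [norm_mul]
  exact (mul_le_mul_of_nonneg_right (hb x) (norm_nonneg _)).trans
    (norm_sq_mul_norm_airyKernel_le (le_max_left _ _) (le_max_right _ _) x)

lemma hasDerivAt_airyKernel_left (z ξ : ℂ) :
    HasDerivAt (fun z => airyKernel z ξ) (Complex.I * ξ * airyKernel z ξ) z := by
  unfold airyKernel
  have h : HasDerivAt (fun z : ℂ => Complex.I * ξ ^ 3 / 3 + Complex.I * z * ξ)
      (Complex.I * ξ) z := by
    have := (((hasDerivAt_id z).const_mul Complex.I).mul_const ξ).const_add (Complex.I * ξ ^ 3 / 3)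
    simpa using this
  exact h.cexp.congr_deriv (by ring)

lemma hasDerivAt_airyKernel_right (z ξ : ℂ) :
    HasDerivAt (airyKernel z) (Complex.I * (ξ ^ 2 + z) * airyKernel z ξ) ξ := by
  unfold airyKernel
  have h : HasDerivAt (fun ξ : ℂ => Complex.I * ξ ^ 3 / 3 + Complex.I * z * ξ)
      (Complex.I * (ξ ^ 2 + z)) ξ := by
    have h1 := ((hasDerivAt_pow 3 ξ).const_mul Complex.I).div_const 3
    have h2 := (hasDerivAt_id ξ).const_mul (Complex.I * z)
    exact (h1.add h2).congr_deriv (by push_cast; ring)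
  exact h.cexp.congr_deriv (by ring)

/-- Differentiation under the Airy integral, for weights of at most linear growth. -/
lemma hasDerivAt_integral_mul_airyKernel {w : ℝ → ℂ} (hw : Continuous w)
    (hb : ∀ x : ℝ, ‖w x‖ ≤ ‖(x : ℂ) + Complex.I‖) (z : ℂ) :
    HasDerivAt (fun z => ∫ x : ℝ, w x * airyKernel z ((x : ℂ) + Complex.I))
      (∫ x : ℝ, w x * (Complex.I * ((x : ℂ) + Complex.I)) *
        airyKernel z ((x : ℂ) + Complex.I)) z := by
  set A := max |z.re| |z.im| + 1
  have hb2 : ∀ x : ℝ, ‖w x‖ ≤ ‖(x : ℂ) + Complex.I‖ ^ 2 := fun x =>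
    (hb x).trans (by nlinarith [one_le_norm_add_I x])
  have hb3 : ∀ x : ℝ, ‖w x * (Complex.I * ((x : ℂ) + Complex.I))‖ ≤
      ‖(x : ℂ) + Complex.I‖ ^ 2 := fun x => by
    rw [norm_mul, norm_mul, Complex.norm_I, one_mul, sq]
    exact mul_le_mul_of_nonneg_right (hb x) (norm_nonneg _)
  have hw3 : Continuous fun x : ℝ => w x * (Complex.I * ((x : ℂ) + Complex.I)) := by fun_prop
  refine (hasDerivAt_integral_of_dominated_loc_of_deriv_le
    (F' := fun z (x : ℝ) => w x * (Complex.I * ((x : ℂ) + Complex.I)) *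
        airyKernel z ((x : ℂ) + Complex.I))
    (bound := fun x => 4 * Real.exp (1 / 3 + A + A ^ 2 / 2) * Real.exp (-(1 / 4) * x ^ 2))
    (Metric.ball_mem_nhds z one_pos)
    (Eventually.of_forall fun z => (integrable_mul_airyKernel hw hb2 z).aestronglyMeasurable)
    (integrable_mul_airyKernel hw hb2 z) (integrable_mul_airyKernel hw3 hb3 z).aestronglyMeasurable
    (ae_of_all _ fun x z' hz' => ?_)
    ((integrable_exp_neg_mul_sq (b := 1 / 4) (by norm_num)).const_mul _)
    (ae_of_all _ fun x z' _ => ?_)).2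
  · have hd : ‖z' - z‖ < 1 := by simpa [dist_eq_norm] using hz'
    have h1 : |z'.re| ≤ A := by
      have h := Complex.abs_re_le_norm (z' - z)
      rw [Complex.sub_re] at h
      have := abs_sub_abs_le_abs_sub z'.re z.re
      have := le_max_left |z.re| |z.im|
      simp only [A]
      linarith
    have h2 : |z'.im| ≤ A := by
      have h := Complex.abs_im_le_norm (z' - z)
      rw [Complex.sub_im] at h
      have := abs_sub_abs_le_abs_sub z'.im z.im
      have := le_max_right |z.re| |z.im|
      simp only [A]
      linarith
    rw [norm_mul]
    exact (mul_le_mul_of_nonneg_right (hb3 x) (norm_nonneg _)).trans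
      (norm_sq_mul_norm_airyKernel_le h1 h2 x)
  · exact ((hasDerivAt_airyKernel_left z' ((x : ℂ) + Complex.I)).const_mul (w x)).congr_deriv
      (by ring)

lemma norm_one_div_I_mul_le (x : ℝ) :
    ‖1 / (Complex.I * ((x : ℂ) + Complex.I))‖ ≤ 1 := by
  rw [norm_div, norm_mul, Complex.norm_I, one_mul, norm_one]
  exact div_le_one_of_le₀ (one_le_norm_add_I x) (norm_nonneg _)

lemma continuous_one_div_I_mul :
    Continuous fun x : ℝ => 1 / (Complex.I * ((x : ℂ) + Complex.I)) :=
  Continuous.div continuous_const (by fun_prop) fun x =>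
    mul_ne_zero Complex.I_ne_zero (add_I_ne_zero x)

lemma airy_eq (z : ℂ) : airy z = (1 / (2 * (Real.pi : ℂ))) *
    ∫ x : ℝ, 1 * airyKernel z ((x : ℂ) + Complex.I) := by
  simp only [airy, airyKernel, one_mul]

lemma hasDerivAt_airyPrim (z : ℂ) : HasDerivAt airyPrim (airy z) z := by
  rw [airy_eq]
  refine ((hasDerivAt_integral_mul_airyKernel continuous_one_div_I_mul
    (fun x => (norm_one_div_I_mul_le x).trans (one_le_norm_add_I x)) z).const_mul
    (1 / (2 * (Real.pi : ℂ)))).congr_deriv ?_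
  congr 2
  funext x
  rw [one_div_mul_cancel (mul_ne_zero Complex.I_ne_zero (add_I_ne_zero x))]

lemma hasDerivAt_airy (z : ℂ) : HasDerivAt airy (airyDeriv z) z := by
  have h := (hasDerivAt_integral_mul_airyKernel (w := fun _ => 1) continuous_const
    (fun x => by simpa using one_le_norm_add_I x) z).const_mul (1 / (2 * (Real.pi : ℂ)))
  simp only [one_mul] at h
  have h' : airy = fun z => (1 / (2 * (Real.pi : ℂ))) *
      ∫ x : ℝ, airyKernel z ((x : ℂ) + Complex.I) := by
    funext z
    simpa only [one_mul] using airy_eq z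
  rw [h']
  exact h

/-- The Airy equation `Ai'' = z Ai`: the integrand of `Ai'' - z Ai` is the derivative in `ξ` of a
multiple of the Airy kernel. -/
lemma hasDerivAt_airyDeriv (z : ℂ) : HasDerivAt airyDeriv (z * airy z) z := by
  have h := (hasDerivAt_integral_mul_airyKernel (w := fun x => Complex.I * ((x : ℂ) + Complex.I))
    (by fun_prop) (fun x => by simp) z).const_mul (1 / (2 * (Real.pi : ℂ)))
  refine h.congr_deriv ?_
  rw [airy_eq, mul_left_comm]
  congr 1
  rw [← integral_const_mul z]
  have hi1 : Integrable fun x : ℝ => airyKernel z ((x : ℂ) + Complex.I) := by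
    simpa using integrable_mul_airyKernel (w := fun _ => 1) continuous_const
      (fun x => by
        rw [norm_one]
        exact one_le_pow₀ (one_le_norm_add_I x)) z
  have hi2 : Integrable fun x : ℝ => ((x : ℂ) + Complex.I) ^ 2 *
      airyKernel z ((x : ℂ) + Complex.I) :=
    integrable_mul_airyKernel (by fun_prop) (fun x => by simp) z
  have h0 : ∫ x : ℝ, Complex.I * (((x : ℂ) + Complex.I) ^ 2 + z) *
      airyKernel z ((x : ℂ) + Complex.I) = 0 := by
    refine integral_eq_zero_of_hasDerivAt_of_integrable
      (f := fun x : ℝ => airyKernel z ((x : ℂ) + Complex.I)) (fun x => ?_) ?_ hi1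
    · have h1 : HasDerivAt (fun x : ℂ => airyKernel z (x + Complex.I)) _ (x : ℂ) :=
        HasDerivAt.comp_add_const (x : ℂ) Complex.I
          (hasDerivAt_airyKernel_right z ((x : ℂ) + Complex.I))
      exact h1.comp_ofReal
    · refine ((hi2.add (hi1.const_mul z)).const_mul Complex.I).congr (ae_of_all _ fun x => ?_)
      simp only [Pi.add_apply]
      ring
  have hi3 : Integrable fun x : ℝ => Complex.I * ((x : ℂ) + Complex.I) *
      (Complex.I * ((x : ℂ) + Complex.I)) * airyKernel z ((x : ℂ) + Complex.I) :=
    integrable_mul_airyKernel (by fun_prop) (fun x => by simp [sq]) z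
  rw [← sub_eq_zero, ← integral_sub hi3 (by simpa using hi1.const_mul z),
    ← mul_zero Complex.I, ← h0, ← integral_const_mul]
  congr 1
  funext x
  linear_combination (-z * airyKernel z ((x : ℂ) + Complex.I)) * Complex.I_sq

/-! ### Decay of the Airy function in a sector -/

/-- The integrand of `airyPrim` as a function of the integration variable. -/
noncomputable def airyPrimIntegrand (z ξ : ℂ) : ℂ := 1 / (Complex.I * ξ) * airyKernel z ξ

lemma norm_airyPrimIntegrand_le (z : ℂ) (x : ℝ) {y : ℝ} (hy : 1 ≤ y) :
    ‖airyPrimIntegrand z ((x : ℂ) + (y : ℂ) * Complex.I)‖ ≤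
      Real.exp (y ^ 3 / 3 - y * x ^ 2 - z.re * y - z.im * x) := by
  rw [airyPrimIntegrand, norm_mul, norm_airyKernel]
  refine mul_le_of_le_one_left (Real.exp_nonneg _) ?_
  rw [norm_div, norm_mul, Complex.norm_I, one_mul, norm_one]
  refine div_le_one_of_le₀ ?_ (norm_nonneg _)
  have h := Complex.abs_im_le_norm ((x : ℂ) + (y : ℂ) * Complex.I)
  have h2 : ((x : ℂ) + (y : ℂ) * Complex.I).im = y := by simp
  rw [h2] at h
  exact hy.trans ((le_abs_self y).trans h)

lemma airyPrimIntegrand_differentiableAt (z : ℂ) {ξ : ℂ} (hξ : ξ ≠ 0) :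
    DifferentiableAt ℂ (airyPrimIntegrand z) ξ := by
  unfold airyPrimIntegrand
  refine DifferentiableAt.mul ?_ (hasDerivAt_airyKernel_right z ξ).differentiableAt
  exact DifferentiableAt.div (by fun_prop) (by fun_prop) (mul_ne_zero Complex.I_ne_zero hξ)

/-- Completing the square: the integrand on the line of height `y` is bounded by a Gaussian. -/
lemma norm_airyPrimIntegrand_le_gaussian (z : ℂ) (x : ℝ) {y : ℝ} (hy : 1 ≤ y) :
    ‖airyPrimIntegrand z ((x : ℂ) + (y : ℂ) * Complex.I)‖ ≤
      Real.exp (y ^ 3 / 3 - z.re * y + z.im ^ 2 / (4 * y)) *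
        Real.exp (-1 * (x + z.im / (2 * y)) ^ 2) := by
  refine (norm_airyPrimIntegrand_le z x hy).trans ?_
  rw [← Real.exp_add]
  refine Real.exp_le_exp.2 ?_
  have hy0 : y ≠ 0 := by positivity
  have h : y * (x + z.im / (2 * y)) ^ 2 = y * x ^ 2 + z.im * x + z.im ^ 2 / (4 * y) := by
    field_simp
    ring
  nlinarith [sq_nonneg (x + z.im / (2 * y))]

lemma integrable_airyPrimIntegrand (z : ℂ) {y : ℝ} (hy : 1 ≤ y) :
    Integrable fun x : ℝ => airyPrimIntegrand z ((x : ℂ) + (y : ℂ) * Complex.I) := by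
  refine (((integrable_exp_neg_mul_sq (b := 1) one_pos).comp_add_right
    (z.im / (2 * y))).const_mul _).mono' ?_
    (ae_of_all _ fun x => norm_airyPrimIntegrand_le_gaussian z x hy)
  refine Continuous.aestronglyMeasurable (continuous_iff_continuousAt.2 fun x => ?_)
  have hne : (x : ℂ) + (y : ℂ) * Complex.I ≠ 0 := fun h => by
    have := congrArg Complex.im h
    simp at this
    linarith
  exact ContinuousAt.comp (f := fun x : ℝ => (x : ℂ) + (y : ℂ) * Complex.I)
    (airyPrimIntegrand_differentiableAt z hne).continuousAt (by fun_prop)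

/-- The vertical sides of the rectangle do not contribute to the contour shift. -/
lemma tendsto_integral_vertical (z : ℂ) {y : ℝ} (hy : 1 ≤ y) (ε : ℝ) (hε : |ε| = 1) :
    Tendsto (fun T : ℝ => ∫ v in (1 : ℝ)..y,
      airyPrimIntegrand z (((ε * T : ℝ) : ℂ) + (v : ℂ) * Complex.I)) atTop (𝓝 0) := by
  have hε2 : ε ^ 2 = 1 := by rw [← sq_abs, hε, one_pow]
  have hlim : Tendsto (fun T : ℝ => Real.exp (y ^ 3 / 3 + |z.re| * y + z.im ^ 2) *
      Real.exp (-T) * |y - 1|) atTop (𝓝 0) := by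
    have h : Tendsto (fun T : ℝ => Real.exp (-T)) atTop (𝓝 0) := by
      simpa using Real.tendsto_exp_neg_atTop_nhds_zero
    simpa using (h.const_mul (Real.exp (y ^ 3 / 3 + |z.re| * y + z.im ^ 2))).mul_const |y - 1|
  refine squeeze_zero_norm' ?_ hlim
  filter_upwards [eventually_ge_atTop (2 : ℝ)] with T hT
  refine intervalIntegral.norm_integral_le_of_norm_le_const fun v hv => ?_
  rw [uIoc_of_le hy] at hv
  refine (norm_airyPrimIntegrand_le z _ hv.1.le).trans ?_
  rw [← Real.exp_add]
  refine Real.exp_le_exp.2 ?_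
  have h1 : v ^ 3 ≤ y ^ 3 := pow_le_pow_left₀ (by linarith [hv.1]) hv.2 3
  have h2 : -(z.re * v) ≤ |z.re| * y := by
    nlinarith [neg_abs_le z.re, abs_nonneg z.re, hv.1, hv.2]
  have h3 : (ε * T) ^ 2 = T ^ 2 := by rw [mul_pow, hε2, one_mul]
  have h4 : -(z.im * (ε * T)) ≤ z.im ^ 2 + T ^ 2 / 4 := by
    nlinarith [sq_nonneg (z.im + ε * T / 2)]
  rw [h3]
  nlinarith [hv.1, sq_nonneg T]

/-- The line of integration in `airyPrim` may be moved up to any height `y ≥ 1`. -/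
lemma airyPrim_eq_integral (z : ℂ) {y : ℝ} (hy : 1 ≤ y) :
    airyPrim z = (1 / (2 * (Real.pi : ℂ))) *
      ∫ x : ℝ, airyPrimIntegrand z ((x : ℂ) + (y : ℂ) * Complex.I) := by
  have h1 : airyPrim z = (1 / (2 * (Real.pi : ℂ))) *
      ∫ x : ℝ, airyPrimIntegrand z ((x : ℂ) + ((1 : ℝ) : ℂ) * Complex.I) := by
    simp [airyPrim, airyPrimIntegrand]
  rw [h1]
  congr 1
  have hl1 := intervalIntegral_tendsto_integral (integrable_airyPrimIntegrand z le_rfl)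
    tendsto_neg_atTop_atBot tendsto_id
  have hl2 := intervalIntegral_tendsto_integral (integrable_airyPrimIntegrand z hy)
    tendsto_neg_atTop_atBot tendsto_id
  have hv1 := (tendsto_integral_vertical z hy 1 (by simp)).const_mul Complex.I
  have hv2 := (tendsto_integral_vertical z hy (-1) (by simp)).const_mul Complex.I
  have hlim := ((hl1.sub hl2).add hv1).sub hv2
  have hzero : Tendsto (fun _ : ℝ => (0 : ℂ)) atTop (𝓝 0) := tendsto_const_nhds
  have := tendsto_nhds_unique (hlim.congr fun T => ?_) hzero
  · rw [mul_zero, add_zero, sub_zero] at this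
    exact sub_eq_zero.1 this
  · have hrect := Complex.integral_boundary_rect_eq_zero_of_differentiableOn
      (airyPrimIntegrand z) ⟨-T, 1⟩ ⟨T, y⟩ fun ξ hξ => by
        refine (airyPrimIntegrand_differentiableAt z ?_).differentiableWithinAt
        intro h0
        have h2 := hξ.2
        simp only [mem_preimage, uIcc_of_le hy, h0, Complex.zero_im] at h2
        linarith [h2.1]
    simpa using hrect

lemma norm_airyPrim_le (z : ℂ) {y : ℝ} (hy : 1 ≤ y) :
    ‖airyPrim z‖ ≤ Real.exp (y ^ 3 / 3 - z.re * y + z.im ^ 2 / (4 * y)) := by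
  rw [airyPrim_eq_integral z hy, norm_mul]
  have h1 : ‖∫ x : ℝ, airyPrimIntegrand z ((x : ℂ) + (y : ℂ) * Complex.I)‖ ≤
      Real.exp (y ^ 3 / 3 - z.re * y + z.im ^ 2 / (4 * y)) * √Real.pi := by
    refine (norm_integral_le_of_norm_le (((integrable_exp_neg_mul_sq (b := 1)
      one_pos).comp_add_right (z.im / (2 * y))).const_mul _)
      (ae_of_all _ fun x => norm_airyPrimIntegrand_le_gaussian z x hy)).trans (le_of_eq ?_)
    rw [integral_const_mul,
      integral_add_right_eq_self (fun x : ℝ => Real.exp (-1 * x ^ 2)) (z.im / (2 * y)),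
      integral_gaussian, div_one]
  have hpi := Real.pi_gt_three
  have h2 : ‖(1 / (2 * (Real.pi : ℂ)))‖ = 1 / (2 * Real.pi) := by
    rw [norm_div, norm_mul, Complex.norm_real, Real.norm_of_nonneg Real.pi_pos.le]
    simp
  have h3 : √Real.pi ≤ 2 * Real.pi := by
    rw [Real.sqrt_le_left (by positivity)]
    nlinarith
  rw [h2, one_div_mul_eq_div, div_le_iff₀ (by positivity)]
  exact h1.trans (by gcongr)

/-- A region around the points `c ρ` (with `c = (√3 ∓ i) / 2`) and `ρ`, with slack `m`, in which
the Airy function is bounded in terms of `ρ`. -/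
def NearRay (m ρ : ℝ) (z : ℂ) : Prop := √3 / 2 * ρ - m ≤ z.re ∧ |z.im| ≤ ρ / 2 + m

lemma NearRay.of_dist {m ρ : ℝ} {z w : ℂ} (h : NearRay m ρ z) (hw : ‖w - z‖ ≤ 1) :
    NearRay (m + 1) ρ w := by
  have h1 := Complex.abs_re_le_norm (w - z)
  have h2 := Complex.abs_im_le_norm (w - z)
  rw [Complex.sub_re] at h1
  rw [Complex.sub_im] at h2
  have h3 := abs_sub_abs_le_abs_sub w.im z.im
  obtain ⟨h4, h5⟩ := h
  exact ⟨by linarith [(abs_le.1 (h1.trans hw)).1], by linarith⟩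

/-- On the line of height `√(ρ + 1)` the cubic phase gains a factor `exp(-ρ^{3/2}/3)`, which
dominates `exp(-4ρ)`. -/
lemma norm_airyPrim_le_of_nearRay {ρ : ℝ} (hρ : 0 ≤ ρ) {z : ℂ} (h : NearRay 3 ρ z) :
    ‖airyPrim z‖ ≤ Real.exp 100 * Real.exp (-4 * ρ) := by
  set t := √(ρ + 1)
  have ht2 : t ^ 2 = ρ + 1 := Real.sq_sqrt (by linarith)
  have ht : 1 ≤ t := Real.one_le_sqrt.2 (by linarith)
  refine (norm_airyPrim_le z ht).trans ?_
  rw [← Real.exp_add]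
  refine Real.exp_le_exp.2 ?_
  have hs : (0.86 : ℝ) ≤ √3 / 2 := by
    have : (1.72 : ℝ) ≤ √3 := Real.le_sqrt_of_sq_le (by norm_num)
    linarith
  have hre : 0.86 * (t ^ 2 - 1) - 3 ≤ z.re := by
    nlinarith [h.1, mul_le_mul_of_nonneg_right hs hρ]
  have him : z.im ^ 2 ≤ ((t ^ 2 + 5) / 2) ^ 2 := by
    refine sq_le_sq' ?_ ?_ <;> linarith [abs_le.1 h.2]
  have h1 : z.im ^ 2 / (4 * t) ≤ t ^ 3 / 16 + 3 * t := by
    rw [div_le_iff₀ (by positivity)]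
    nlinarith
  have h2 : (0.86 * (t ^ 2 - 1) - 3) * t ≤ z.re * t :=
    mul_le_mul_of_nonneg_right hre (by linarith)
  -- it remains to bound a cubic with negative leading coefficient; its maximum is near `t = 7`
  have h3 : 0 ≤ (t - 7) ^ 2 * t := by positivity
  nlinarith [sq_nonneg (t - 7)]

lemma norm_airy_le_of_nearRay {ρ : ℝ} (hρ : 0 ≤ ρ) {z : ℂ} (h : NearRay 2 ρ z) :
    ‖airy z‖ ≤ Real.exp 100 * Real.exp (-4 * ρ) := by
  rw [← (hasDerivAt_airyPrim z).deriv, ← div_one (Real.exp 100 * _)]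
  refine Complex.norm_deriv_le_of_forall_mem_sphere_norm_le one_pos
    (Differentiable.diffContOnCl fun w => (hasDerivAt_airyPrim w).differentiableAt) fun w hw => ?_
  refine norm_airyPrim_le_of_nearRay hρ ?_
  have := h.of_dist (w := w) (by rw [← dist_eq_norm]; exact (Metric.mem_sphere.1 hw).le)
  norm_num at this
  exact this

lemma norm_airyDeriv_le_of_nearRay {ρ : ℝ} (hρ : 0 ≤ ρ) {z : ℂ} (h : NearRay 1 ρ z) :
    ‖airyDeriv z‖ ≤ Real.exp 100 * Real.exp (-4 * ρ) := by
  rw [← (hasDerivAt_airy z).deriv, ← div_one (Real.exp 100 * _)]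
  refine Complex.norm_deriv_le_of_forall_mem_sphere_norm_le one_pos
    (Differentiable.diffContOnCl fun w => (hasDerivAt_airy w).differentiableAt) fun w hw => ?_
  refine norm_airy_le_of_nearRay hρ ?_
  have := h.of_dist (w := w) (by rw [← dist_eq_norm]; exact (Metric.mem_sphere.1 hw).le)
  norm_num at this
  exact this

/-! ### The Airy function has nonzero mass on the half-line -/

lemma airy_ne_zero : airy ≠ 0 := by
  intro h0
  set f : ℝ → ℂ := fun x => airyKernel 0 ((x : ℂ) + Complex.I) with hf
  have hfc : Continuous f := continuous_airyKernel_I 0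
  have hfi : Integrable f := by
    simpa using integrable_mul_airyKernel (w := fun _ => 1) continuous_const
      (fun x => by
        rw [norm_one]
        exact one_le_pow₀ (one_le_norm_add_I x)) 0
  have hF : FourierTransform.fourier f = 0 := by
    funext w
    rw [Real.fourier_eq', Pi.zero_apply]
    have h := congrFun h0 ((-2 * Real.pi * w : ℝ) : ℂ)
    rw [airy_eq, Pi.zero_apply] at h
    have h1 : ∫ x : ℝ, 1 * airyKernel ((-2 * Real.pi * w : ℝ) : ℂ) ((x : ℂ) + Complex.I) = 0 := by
      refine (mul_eq_zero.1 h).resolve_left ?_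
      have := Real.pi_ne_zero
      simp [this]
    rw [← mul_zero (Complex.exp ((-2 * Real.pi * w : ℝ) : ℂ)), ← h1, ← integral_const_mul]
    congr 1
    funext x
    simp only [hf, airyKernel, smul_eq_mul, one_mul, ← Complex.exp_add]
    congr 1
    simp only [RCLike.inner_apply, conj_trivial]
    push_cast
    linear_combination (2 * Real.pi * w : ℂ) * Complex.I_sq
  have hinv := hfc.fourierInv_fourier_eq hfi (by rw [hF]; exact integrable_zero _ _ _)
  have h1 := congrFun hinv 0
  rw [hF, Real.fourierInv_eq'] at h1
  simp only [Pi.zero_apply, smul_zero, integral_zero] at h1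
  exact Complex.exp_ne_zero _ h1.symm

lemma conj_airyKernel (z : ℂ) (x : ℝ) :
    (starRingEnd ℂ) (airyKernel z ((x : ℂ) + Complex.I)) =
      airyKernel ((starRingEnd ℂ) z) (((-x : ℝ) : ℂ) + Complex.I) := by
  simp only [airyKernel, ← Complex.exp_conj]
  congr 1
  simp only [map_add, map_mul, map_div₀, map_pow, Complex.conj_I, Complex.conj_ofReal,
    map_ofNat]
  push_cast
  ring

/-- The Airy function takes conjugate values at conjugate points: reflect the line `ℝ + i` in the
imaginary axis. -/
lemma airy_conj (z : ℂ) : airy ((starRingEnd ℂ) z) = (starRingEnd ℂ) (airy z) := by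
  rw [airy_eq, airy_eq, map_mul, ← integral_conj, ← integral_neg_eq_self]
  congr 1
  · simp only [map_div₀, map_mul, map_one, map_ofNat, Complex.conj_ofReal]
  · congr 1
    funext x
    rw [map_mul, conj_airyKernel]
    simp

lemma airy_ofReal_im (t : ℝ) : (airy (t : ℂ)).im = 0 := by
  rw [← Complex.conj_eq_iff_im, ← airy_conj, Complex.conj_ofReal]

lemma nearRay_ofReal {t : ℝ} (ht : 0 ≤ t) {m : ℝ} (hm : 0 ≤ m) : NearRay m t (t : ℂ) := by
  have : √3 / 2 ≤ 1 := by
    have : √3 ≤ 2 := Real.sqrt_le_iff.2 ⟨by norm_num, by norm_num⟩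
    linarith
  refine ⟨?_, ?_⟩
  · rw [Complex.ofReal_re]
    nlinarith
  · rw [Complex.ofReal_im, abs_zero]
    positivity

lemma tendsto_zero_of_norm_le_exp {E : Type*} [NormedAddCommGroup E] {f : ℝ → E} {K : ℝ}
    (h : ∀ t : ℝ, 0 ≤ t → ‖f t‖ ≤ K * Real.exp (-4 * t)) : Tendsto f atTop (𝓝 0) := by
  have h1 : Tendsto (fun t : ℝ => K * Real.exp (-4 * t)) atTop (𝓝 0) := by
    have : Tendsto (fun t : ℝ => -4 * t) atTop atBot :=
      tendsto_id.const_mul_atTop_of_neg (by norm_num)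
    simpa using (Real.tendsto_exp_atBot.comp this).const_mul K
  refine squeeze_zero_norm' ?_ h1
  filter_upwards [eventually_ge_atTop (0 : ℝ)] with t ht using h t ht

lemma hasDerivAt_airy_re (t : ℝ) :
    HasDerivAt (fun t : ℝ => (airy (t : ℂ)).re) (airyDeriv (t : ℂ)).re t :=
  (hasDerivAt_airy (t : ℂ)).real_of_complex

lemma hasDerivAt_airyDeriv_re (t : ℝ) :
    HasDerivAt (fun t : ℝ => (airyDeriv (t : ℂ)).re) (t * (airy (t : ℂ)).re) t := by
  have h := (hasDerivAt_airyDeriv (t : ℂ)).real_of_complex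
  rwa [Complex.re_ofReal_mul] at h

/-- `Ai Ai'` is nondecreasing on `[0, ∞)`, because `(Ai Ai')' = Ai'² + t Ai²`, and it tends to `0`.
-/
lemma airy_re_mul_airyDeriv_re_nonpos {t : ℝ} (ht : 0 ≤ t) :
    (airy (t : ℂ)).re * (airyDeriv (t : ℂ)).re ≤ 0 := by
  have hd : ∀ t : ℝ, HasDerivAt (fun t : ℝ => (airy (t : ℂ)).re * (airyDeriv (t : ℂ)).re)
      ((airyDeriv (t : ℂ)).re * (airyDeriv (t : ℂ)).re +
        (airy (t : ℂ)).re * (t * (airy (t : ℂ)).re)) t :=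
    fun t => (hasDerivAt_airy_re t).mul (hasDerivAt_airyDeriv_re t)
  have hmono : MonotoneOn (fun t : ℝ => (airy (t : ℂ)).re * (airyDeriv (t : ℂ)).re) (Ici 0) := by
    refine monotoneOn_of_deriv_nonneg (convex_Ici 0)
      (fun t _ => (hd t).continuousAt.continuousWithinAt)
      (fun t _ => (hd t).differentiableAt.differentiableWithinAt) fun t ht => ?_
    rw [interior_Ici, mem_Ioi] at ht
    rw [(hd t).deriv]
    nlinarith [mul_self_nonneg (airyDeriv (t : ℂ)).re,
      mul_nonneg ht.le (mul_self_nonneg (airy (t : ℂ)).re)]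
  have hl1 : Tendsto (fun t : ℝ => airy (t : ℂ)) atTop (𝓝 0) :=
    tendsto_zero_of_norm_le_exp fun t ht =>
      norm_airy_le_of_nearRay ht (nearRay_ofReal ht (by norm_num))
  have hl2 : Tendsto (fun t : ℝ => airyDeriv (t : ℂ)) atTop (𝓝 0) :=
    tendsto_zero_of_norm_le_exp fun t ht =>
      norm_airyDeriv_le_of_nearRay ht (nearRay_ofReal ht (by norm_num))
  have hlim : Tendsto (fun t : ℝ => (airy (t : ℂ)).re * (airyDeriv (t : ℂ)).re) atTop (𝓝 0) := by
    simpa using ((Complex.continuous_re.tendsto _).comp hl1).mul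
      ((Complex.continuous_re.tendsto _).comp hl2)
  refine ge_of_tendsto hlim ?_
  filter_upwards [eventually_ge_atTop t] with u hu using hmono ht (mem_Ici.2 (ht.trans hu)) hu

/-- The Airy function has no zero on `[0, ∞)`: its square is nonincreasing there, so that it would
vanish beyond such a zero, and then identically. -/
lemma airy_re_ne_zero {t : ℝ} (ht : 0 ≤ t) : (airy (t : ℂ)).re ≠ 0 := by
  intro h0
  have hd : ∀ t : ℝ, HasDerivAt (fun t : ℝ => (airy (t : ℂ)).re ^ 2)
      (2 * (airy (t : ℂ)).re ^ 1 * (airyDeriv (t : ℂ)).re) t :=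
    fun t => (hasDerivAt_airy_re t).pow 2
  have hanti : AntitoneOn (fun t : ℝ => (airy (t : ℂ)).re ^ 2) (Ici 0) := by
    refine antitoneOn_of_deriv_nonpos (convex_Ici 0)
      (fun t _ => (hd t).continuousAt.continuousWithinAt)
      (fun t _ => (hd t).differentiableAt.differentiableWithinAt) fun t ht => ?_
    rw [interior_Ici, mem_Ioi] at ht
    rw [(hd t).deriv]
    nlinarith [airy_re_mul_airyDeriv_re_nonpos ht.le]
  have hzero : ∀ u : ℝ, t ≤ u → airy (u : ℂ) = 0 := fun u hu => by
    have h := hanti (mem_Ici.2 ht) (mem_Ici.2 (ht.trans hu)) hu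
    simp only [h0] at h
    have hre : (airy (u : ℂ)).re = 0 := by
      rw [← sq_eq_zero_iff]
      exact le_antisymm (h.trans_eq (by norm_num)) (sq_nonneg _)
    exact Complex.ext hre (airy_ofReal_im u)
  have han : AnalyticOnNhd ℂ airy univ :=
    DifferentiableOn.analyticOnNhd
      (fun z _ => (hasDerivAt_airy z).differentiableAt.differentiableWithinAt) isOpen_univ
  refine airy_ne_zero (han.eq_of_frequently_eq (z₀ := (t : ℂ)) (fun z _ => analyticAt_const) ?_)
  have hseq : Tendsto (fun k : ℕ => ((t + 1 / ((k : ℝ) + 1) : ℝ) : ℂ)) atTop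
      (𝓝[≠] (t : ℂ)) := by
    refine tendsto_nhdsWithin_iff.2 ⟨?_, Eventually.of_forall fun k => ?_⟩
    · have := (tendsto_one_div_add_atTop_nhds_zero_nat (𝕜 := ℝ)).const_add t
      rw [add_zero] at this
      exact (Complex.continuous_ofReal.tendsto t).comp this
    · have : (0 : ℝ) < 1 / ((k : ℝ) + 1) := by positivity
      simp only [mem_compl_iff, mem_singleton_iff, Complex.ofReal_inj]
      linarith
  refine hseq.frequently (Frequently.of_forall fun k => ?_)
  have : (0 : ℝ) < 1 / ((k : ℝ) + 1) := by positivity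
  exact hzero _ (by linarith)

lemma lt_zero_of_deriv_pos_of_tendsto {p a : ℝ → ℝ} (hp : ∀ t, HasDerivAt p (a t) t)
    (ha : ∀ t, 0 ≤ t → 0 < a t) (hlim : Tendsto p atTop (𝓝 0)) : p 0 < 0 := by
  have hm : StrictMonoOn p (Ici 0) := by
    refine strictMonoOn_of_deriv_pos (convex_Ici 0)
      (fun t _ => (hp t).continuousAt.continuousWithinAt) fun t ht => ?_
    rw [interior_Ici] at ht
    rw [(hp t).deriv]
    exact ha t (le_of_lt ht)
  have h1 : p 0 < p 1 := hm (by simp) (by simp) one_pos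
  refine h1.trans_le (ge_of_tendsto hlim ?_)
  filter_upwards [eventually_ge_atTop (1 : ℝ)] with u hu using
    hm.monotoneOn (by simp) (mem_Ici.2 (zero_le_one.trans hu)) hu

/-- `P(0) = -∫₀^∞ Ai ≠ 0`, as `Ai` has constant sign on `[0, ∞)`. -/
lemma airyPrim_zero_ne_zero : airyPrim 0 ≠ 0 := by
  intro h0
  have hp : ∀ t : ℝ, HasDerivAt (fun t : ℝ => (airyPrim (t : ℂ)).re) (airy (t : ℂ)).re t :=
    fun t => (hasDerivAt_airyPrim (t : ℂ)).real_of_complex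
  have hl : Tendsto (fun t : ℝ => airyPrim (t : ℂ)) atTop (𝓝 0) :=
    tendsto_zero_of_norm_le_exp fun t ht =>
      norm_airyPrim_le_of_nearRay ht (nearRay_ofReal ht (by norm_num))
  have hlim : Tendsto (fun t : ℝ => (airyPrim (t : ℂ)).re) atTop (𝓝 0) :=
    (Complex.continuous_re.tendsto _).comp hl
  have hp0 : (airyPrim ((0 : ℝ) : ℂ)).re = 0 := by simp [h0]
  rcases hasDerivWithinAt_forall_lt_or_forall_gt_of_forall_ne (convex_Ici (0 : ℝ))
    (fun t _ => (hp t).hasDerivWithinAt) (m := 0) (fun t ht => airy_re_ne_zero ht) with h | h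
  · have := lt_zero_of_deriv_pos_of_tendsto (fun t => (hp t).neg)
      (fun t ht => neg_pos.2 (h t ht)) (neg_zero (G := ℝ) ▸ hlim.neg)
    simp only [Pi.neg_apply, hp0, neg_zero, lt_self_iff_false] at this
  · have := lt_zero_of_deriv_pos_of_tendsto hp h hlim
    simp only [hp0, lt_self_iff_false] at this

/-! ### Tail integrals -/

lemma hasDerivAt_integral_Ioi {k : ℝ → ℂ} {a r : ℝ} (hk : ContinuousOn k (Ioi a))
    (hi : ∀ x, a < x → IntegrableOn k (Ioi x)) (hr : a < r) :
    HasDerivAt (fun x => ∫ s in Ioi x, k s) (-k r) r := by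
  obtain ⟨b, hab, hbr⟩ := exists_between hr
  have hint : ∀ x, b ≤ x → IntervalIntegrable k volume b x := fun x hx =>
    (intervalIntegrable_iff_integrableOn_Ioc_of_le hx).2 ((hi b hab).mono_set Ioc_subset_Ioi_self)
  have h1 : HasDerivAt (fun x => ∫ s in b..x, k s) (k r) r :=
    intervalIntegral.integral_hasDerivAt_right (hint r hbr.le)
      (hk.stronglyMeasurableAtFilter isOpen_Ioi r hr) (hk.continuousAt (Ioi_mem_nhds hr))
  refine (h1.const_sub (∫ s in Ioi b, k s)).congr_of_eventuallyEq ?_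
  filter_upwards [Ioi_mem_nhds hbr] with x hx
  have hx' : b ≤ x := le_of_lt hx
  rw [intervalIntegral.integral_of_le hx', eq_sub_iff_add_eq', ← setIntegral_union
    (Ioc_disjoint_Ioi le_rfl) measurableSet_Ioi ((hi b hab).mono_set Ioc_subset_Ioi_self)
    (hi x (hab.trans_le hx')), Ioc_union_Ioi_eq_Ioi hx']

lemma contDiffOn_integral_Ioi {k : ℝ → ℂ} {a : ℝ} (hk : ContDiffOn ℝ ∞ k (Ioi a))
    (hi : ∀ x, a < x → IntegrableOn k (Ioi x)) :
    ContDiffOn ℝ ∞ (fun x => ∫ s in Ioi x, k s) (Ioi a) := by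
  have hd := fun r (hr : r ∈ Ioi a) => hasDerivAt_integral_Ioi hk.continuousOn hi hr
  rw [contDiffOn_infty_iff_deriv_of_isOpen isOpen_Ioi]
  exact ⟨fun r hr => (hd r hr).differentiableAt.differentiableWithinAt,
    hk.neg.congr fun r hr => (hd r hr).deriv⟩

/-- Exponential bound with rate `4` on the half-line. -/
def ExpBounded (K : ℝ) (f : ℝ → ℂ) : Prop := ∀ ρ : ℝ, 0 ≤ ρ → ‖f ρ‖ ≤ K * Real.exp (-4 * ρ)

lemma ExpBounded.nonneg {K : ℝ} {f : ℝ → ℂ} (h : ExpBounded K f) : 0 ≤ K := by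
  have := (norm_nonneg _).trans (h 0 le_rfl)
  simpa using this

/-- `τ ↦ ∫_τ^∞ exp(-d(σ-τ)) f(σ) dσ`, the solution of `V' = d V - f` that decays at infinity. -/
noncomputable def expTail (d : ℝ) (f : ℝ → ℂ) (τ : ℝ) : ℂ :=
  ∫ σ in Ioi τ, (Real.exp (-d * (σ - τ)) : ℂ) * f σ

lemma integrableOn_exp_mul {K d : ℝ} {f : ℝ → ℂ} (hf : Continuous f) (hK : ExpBounded K f)
    (hd : |d| ≤ 1) (τ : ℝ) : IntegrableOn (fun σ => (Real.exp (-d * σ) : ℂ) * f σ) (Ioi τ) := by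
  have hc : Continuous fun σ : ℝ => (Real.exp (-d * σ) : ℂ) * f σ := by fun_prop
  refine (integrable_norm_iff hc.aestronglyMeasurable).1 ?_
  refine integrable_of_isBigO_exp_neg (b := 3) (by norm_num) hc.norm.continuousOn ?_
  refine Asymptotics.IsBigO.of_bound K ?_
  filter_upwards [eventually_ge_atTop (0 : ℝ)] with σ hσ
  rw [norm_norm, norm_mul, Complex.norm_real, Real.norm_of_nonneg (Real.exp_nonneg _),
    Real.norm_of_nonneg (Real.exp_nonneg _)]
  have hK0 : 0 ≤ K := hK.nonneg
  calc Real.exp (-d * σ) * ‖f σ‖ ≤ Real.exp (1 * σ) * (K * Real.exp (-4 * σ)) := by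
        gcongr
        · linarith [(abs_le.1 hd).1]
        · exact hK σ hσ
    _ = K * Real.exp (-3 * σ) := by
        rw [mul_left_comm, ← Real.exp_add]
        congr 2
        ring

lemma expTail_eq (d : ℝ) (f : ℝ → ℂ) (τ : ℝ) :
    expTail d f τ = (Real.exp (d * τ) : ℂ) * ∫ σ in Ioi τ, (Real.exp (-d * σ) : ℂ) * f σ := by
  rw [expTail, ← integral_const_mul]
  congr 1
  funext σ
  rw [← mul_assoc, ← Complex.ofReal_mul, ← Real.exp_add]
  congr 3
  ring

lemma hasDerivAt_expTail {K d : ℝ} {f : ℝ → ℂ} (hf : Continuous f) (hK : ExpBounded K f)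
    (hd : |d| ≤ 1) (τ : ℝ) : HasDerivAt (expTail d f) (d * expTail d f τ - f τ) τ := by
  have h1 := hasDerivAt_integral_Ioi (a := τ - 1) (r := τ)
    (k := fun σ => (Real.exp (-d * σ) : ℂ) * f σ) (by fun_prop)
    (fun x _ => integrableOn_exp_mul hf hK hd x) (by linarith)
  have h2 : HasDerivAt (fun τ : ℝ => (Real.exp (d * τ) : ℂ)) ((Real.exp (d * τ) * d : ℝ) : ℂ)
      τ := by
    have := ((hasDerivAt_id τ).const_mul d).exp.ofReal_comp
    simpa using this
  have h3 : expTail d f = fun τ => (Real.exp (d * τ) : ℂ) *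
      ∫ σ in Ioi τ, (Real.exp (-d * σ) : ℂ) * f σ := funext (expTail_eq d f)
  rw [h3]
  refine (h2.mul h1).congr_deriv ?_
  have h4 : (Real.exp (d * τ) : ℂ) * (Real.exp (-d * τ) : ℂ) = 1 := by
    rw [← Complex.ofReal_mul, ← Real.exp_add]
    simp
  push_cast at h4 ⊢
  linear_combination (-f τ) * h4

lemma contDiff_ofReal : ContDiff ℝ ∞ (fun x : ℝ => (x : ℂ)) := Complex.ofRealCLM.contDiff

lemma contDiff_ofReal_exp (d : ℝ) : ContDiff ℝ ∞ (fun x : ℝ => (Real.exp (d * x) : ℂ)) :=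
  contDiff_ofReal.comp (by fun_prop : ContDiff ℝ ∞ fun x : ℝ => Real.exp (d * x))

lemma contDiff_expTail {K d : ℝ} {f : ℝ → ℂ} (hf : ContDiff ℝ ∞ f) (hK : ExpBounded K f)
    (hd : |d| ≤ 1) : ContDiff ℝ ∞ (expTail d f) := by
  rw [funext (expTail_eq d f)]
  refine ContDiff.mul (contDiff_ofReal_exp d) (contDiff_iff_contDiffAt.2 fun τ => ?_)
  exact (contDiffOn_integral_Ioi (a := τ - 1) ((contDiff_ofReal_exp (-d)).mul hf).contDiffOn
    (fun x _ => integrableOn_exp_mul hf.continuous hK hd x)).contDiffAt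
    (Ioi_mem_nhds (by linarith))

lemma ExpBounded.expTail {K d : ℝ} {f : ℝ → ℂ} (hK : ExpBounded K f) (hd : |d| ≤ 1) :
    ExpBounded K (expTail d f) := by
  intro τ hτ
  have hK0 : 0 ≤ K := hK.nonneg
  have hi : IntegrableOn (fun σ : ℝ => K * Real.exp (-τ) * Real.exp (-3 * σ)) (Ioi τ) :=
    (integrableOn_exp_mul_Ioi (by norm_num) τ).const_mul _
  refine (norm_integral_le_of_norm_le hi ?_).trans ?_
  · refine (ae_restrict_iff' measurableSet_Ioi).2 (ae_of_all _ fun σ hσ => ?_)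
    rw [mem_Ioi] at hσ
    rw [norm_mul, Complex.norm_real, Real.norm_of_nonneg (Real.exp_nonneg _)]
    calc Real.exp (-d * (σ - τ)) * ‖f σ‖ ≤ Real.exp (1 * (σ - τ)) * (K * Real.exp (-4 * σ)) := by
          refine mul_le_mul (Real.exp_le_exp.2 ?_) (hK σ (hτ.trans hσ.le)) (norm_nonneg _)
            (Real.exp_nonneg _)
          exact mul_le_mul_of_nonneg_right (by linarith [(abs_le.1 hd).1]) (by linarith)
      _ = K * Real.exp (-τ) * Real.exp (-3 * σ) := by
          rw [mul_left_comm, mul_assoc, ← Real.exp_add, ← Real.exp_add]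
          congr 2
          ring
  · rw [integral_const_mul, integral_exp_mul_Ioi (by norm_num), mul_assoc]
    refine mul_le_mul_of_nonneg_left ?_ hK0
    have : Real.exp (-τ) * Real.exp (-3 * τ) = Real.exp (-4 * τ) := by
      rw [← Real.exp_add]
      congr 1
      ring
    nlinarith [Real.exp_pos (-4 * τ)]

/-! ### The layer profile in the reduced parameters `s = ±1`, `δ = |n| / |β|` -/

/-- The direction `(√3 - s i) / 2`, a cube root of `-s i` when `s = ±1`. -/
noncomputable def layerDir (s : ℝ) : ℂ := ((√3 : ℝ) - s * Complex.I) / 2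

/-- The argument `c (ρ + i s δ²)` of the Airy function in the layer. -/
noncomputable def layerPoint (s δ ρ : ℝ) : ℂ := layerDir s * ((ρ : ℂ) + s * δ ^ 2 * Complex.I)

/-- The vorticity profile `ρ ↦ Ai(c (ρ + i s δ²))` of the layer. -/
noncomputable def layer (s δ ρ : ℝ) : ℂ := airy (layerPoint s δ ρ)

/-- The derivative of `layer s δ`. -/
noncomputable def layerDeriv (s δ ρ : ℝ) : ℂ := layerDir s * airyDeriv (layerPoint s δ ρ)

lemma layerDir_cube {s : ℝ} (hs : s ^ 2 = 1) : layerDir s ^ 3 = -s * Complex.I := by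
  have h3 : ((√3 : ℝ) : ℂ) ^ 2 = 3 := by
    rw [← Complex.ofReal_pow, Real.sq_sqrt (by norm_num)]
    norm_num
  have hs' : (s : ℂ) ^ 2 = 1 := by exact_mod_cast hs
  rw [layerDir]
  linear_combination (((√3 : ℝ) : ℂ) / 8 - 3 * s * Complex.I / 8) * h3 +
    ((3 * ((√3 : ℝ) : ℂ) * s ^ 2 - s ^ 3 * Complex.I) / 8) * Complex.I_sq +
    ((s * Complex.I - 3 * ((√3 : ℝ) : ℂ)) / 8) * hs'

lemma layerDir_re (s : ℝ) : (layerDir s).re = √3 / 2 := by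
  simp [layerDir]

lemma layerDir_im (s : ℝ) : (layerDir s).im = -s / 2 := by
  simp [layerDir]

lemma norm_layerDir {s : ℝ} (hs : s ^ 2 = 1) : ‖layerDir s‖ = 1 := by
  have h3 : √3 ^ 2 = 3 := Real.sq_sqrt (by norm_num)
  rw [← sq_eq_sq₀ (norm_nonneg _) zero_le_one, ← Complex.normSq_eq_norm_sq, Complex.normSq_apply,
    layerDir_re, layerDir_im]
  nlinarith

lemma nearRay_layerPoint {s δ ρ : ℝ} (hs : s ^ 2 = 1) (hδ : |δ| ≤ 1) (hρ : 0 ≤ ρ) :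
    NearRay 1 ρ (layerPoint s δ ρ) := by
  have hre : (layerPoint s δ ρ).re = √3 / 2 * ρ + s ^ 2 * δ ^ 2 / 2 := by
    have h : layerPoint s δ ρ = layerDir s * ((ρ : ℂ) + ((s * δ ^ 2 : ℝ) : ℂ) * Complex.I) := by
      simp [layerPoint]
    rw [h]
    simp only [Complex.mul_re, Complex.add_re, Complex.add_im, Complex.mul_im, Complex.ofReal_re,
      Complex.ofReal_im, Complex.I_re, Complex.I_im, layerDir_re, layerDir_im]
    ring
  have him : (layerPoint s δ ρ).im = s * (√3 / 2 * δ ^ 2 - ρ / 2) := by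
    have h : layerPoint s δ ρ = layerDir s * ((ρ : ℂ) + ((s * δ ^ 2 : ℝ) : ℂ) * Complex.I) := by
      simp [layerPoint]
    rw [h]
    simp only [Complex.mul_re, Complex.add_re, Complex.add_im, Complex.mul_im, Complex.ofReal_re,
      Complex.ofReal_im, Complex.I_re, Complex.I_im, layerDir_re, layerDir_im]
    ring
  have hs1 : |s| = 1 := by rwa [← sq_eq_sq₀ (abs_nonneg _) zero_le_one, sq_abs, one_pow]
  have hδ2 : δ ^ 2 ≤ 1 := (sq_le_one_iff_abs_le_one δ).2 hδ
  have h3 : √3 ≤ 2 := Real.sqrt_le_iff.2 ⟨by norm_num, by norm_num⟩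
  have h30 : 0 ≤ √3 := Real.sqrt_nonneg _
  refine ⟨?_, ?_⟩
  · rw [hre, hs]
    linarith [sq_nonneg δ]
  · rw [him, abs_mul, hs1, one_mul, abs_le]
    constructor <;> nlinarith [sq_nonneg δ]

lemma hasDerivAt_layerPoint (s δ ρ : ℝ) : HasDerivAt (layerPoint s δ) (layerDir s) ρ := by
  have := ((Complex.ofRealCLM.hasDerivAt (x := ρ)).add_const
    ((s : ℂ) * δ ^ 2 * Complex.I)).const_mul (layerDir s)
  exact this.congr_deriv (by simp)

lemma hasDerivAt_layer (s δ ρ : ℝ) : HasDerivAt (layer s δ) (layerDeriv s δ ρ) ρ := by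
  refine ((hasDerivAt_airy (layerPoint s δ ρ)).comp ρ (hasDerivAt_layerPoint s δ ρ)).congr_deriv ?_
  rw [layerDeriv, mul_comm]

/-- The layer solves `-W'' + δ² W - i s ρ W = 0`. -/
lemma hasDerivAt_layerDeriv {s : ℝ} (hs : s ^ 2 = 1) (δ ρ : ℝ) :
    HasDerivAt (layerDeriv s δ) ((δ ^ 2 - s * ρ * Complex.I) * layer s δ ρ) ρ := by
  have h := ((hasDerivAt_airyDeriv (layerPoint s δ ρ)).comp ρ
    (hasDerivAt_layerPoint s δ ρ)).const_mul (layerDir s)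
  refine h.congr_deriv ?_
  have hs' : (s : ℂ) ^ 2 = 1 := by exact_mod_cast hs
  have h3 := layerDir_cube hs
  rw [layer]
  have h4 : layerDir s ^ 2 * layerPoint s δ ρ = δ ^ 2 - s * ρ * Complex.I := by
    rw [layerPoint]
    linear_combination ((ρ : ℂ) + s * δ ^ 2 * Complex.I) * h3 -
      s ^ 2 * δ ^ 2 * Complex.I_sq + δ ^ 2 * hs'
  linear_combination airy (layerPoint s δ ρ) * h4

lemma contDiff_layer (s δ : ℝ) : ContDiff ℝ ∞ (layer s δ) := by
  have h1 : ContDiff ℂ ∞ airy :=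
    Differentiable.contDiff fun z => (hasDerivAt_airy z).differentiableAt
  have h2 : ContDiff ℝ ∞ (layerPoint s δ) := by
    unfold layerPoint
    have := contDiff_ofReal
    fun_prop
  exact (h1.restrict_scalars ℝ).comp h2

lemma expBounded_layer {s δ : ℝ} (hs : s ^ 2 = 1) (hδ : |δ| ≤ 1) :
    ExpBounded (Real.exp 100) (layer s δ) := fun ρ hρ =>
  norm_airy_le_of_nearRay hρ ⟨by linarith [(nearRay_layerPoint hs hδ hρ).1],
    by linarith [(nearRay_layerPoint hs hδ hρ).2]⟩

lemma expBounded_layerDeriv {s δ : ℝ} (hs : s ^ 2 = 1) (hδ : |δ| ≤ 1) :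
    ExpBounded (Real.exp 100) (layerDeriv s δ) := fun ρ hρ => by
  rw [layerDeriv, norm_mul, norm_layerDir hs, one_mul]
  exact norm_airyDeriv_le_of_nearRay hρ (nearRay_layerPoint hs hδ hρ)

lemma expTail_zero_layer {s : ℝ} (hs : s ^ 2 = 1) :
    layerDir s * expTail 0 (layer s 0) 0 = -airyPrim 0 := by
  have hd : ∀ ρ : ℝ, HasDerivAt (fun ρ => airyPrim (layerPoint s 0 ρ))
      (layerDir s * layer s 0 ρ) ρ := fun ρ => by
    refine ((hasDerivAt_airyPrim (layerPoint s 0 ρ)).comp ρ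
      (hasDerivAt_layerPoint s 0 ρ)).congr_deriv ?_
    rw [layer, mul_comm]
  have hl : Tendsto (fun ρ => airyPrim (layerPoint s 0 ρ)) atTop (𝓝 0) :=
    tendsto_zero_of_norm_le_exp fun ρ hρ => by
      have := nearRay_layerPoint (δ := 0) hs (by simp) hρ
      exact norm_airyPrim_le_of_nearRay hρ ⟨by linarith [this.1], by linarith [this.2]⟩
  have hi : IntegrableOn (layer s 0) (Ioi 0) := by
    simpa using integrableOn_exp_mul (d := 0) (contDiff_layer s 0).continuous
      (expBounded_layer hs (by simp)) (by simp) 0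
  have h := integral_Ioi_of_hasDerivAt_of_tendsto' (a := 0) (fun x _ => hd x)
    (hi.const_mul (layerDir s)) hl
  rw [integral_const_mul] at h
  have h0 : layerPoint s 0 0 = 0 := by simp [layerPoint]
  rw [h0, zero_sub] at h
  rw [← h, expTail]
  simp

lemma continuous_airy : Continuous airy :=
  continuous_iff_continuousAt.2 fun z => (hasDerivAt_airy z).continuousAt

lemma continuousWithinAt_expTail_layer {s : ℝ} (hs : s ^ 2 = 1) :
    ContinuousWithinAt (fun δ => expTail δ (layer s δ) 0) (Icc 0 1) 0 := by
  unfold expTail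
  refine continuousWithinAt_of_dominated (bound := fun σ => Real.exp 100 * Real.exp (-4 * σ))
    (Eventually.of_forall fun δ => ?_) ?_
    ((integrableOn_exp_mul_Ioi (by norm_num) 0).const_mul _) (ae_of_all _ fun σ => ?_)
  · have := (contDiff_layer s δ).continuous
    exact Continuous.aestronglyMeasurable (by fun_prop)
  · filter_upwards [self_mem_nhdsWithin] with δ hδ
    refine (ae_restrict_iff' measurableSet_Ioi).2 (ae_of_all _ fun σ hσ => ?_)
    rw [mem_Ioi] at hσ
    rw [norm_mul, Complex.norm_real, Real.norm_of_nonneg (Real.exp_nonneg _)]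
    refine (mul_le_of_le_one_left (norm_nonneg _) ?_).trans
      (expBounded_layer hs (abs_le.2 ⟨by linarith [hδ.1], hδ.2⟩) σ hσ.le)
    rw [Real.exp_le_one_iff]
    nlinarith [hδ.1]
  · refine Continuous.continuousWithinAt ?_
    unfold layer layerPoint
    have := continuous_airy
    fun_prop

/-- Nondegeneracy of the layer: at `δ = 0` the boundary value `∫₀^∞ W` is `-P(0)/c`, and it depends
continuously on `δ`. -/
lemma exists_le_norm_expTail_layer : ∃ L δ₁ : ℝ, 0 < L ∧ 0 < δ₁ ∧ δ₁ ≤ 1 ∧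
    ∀ s δ : ℝ, s = 1 ∨ s = -1 → 0 ≤ δ → δ ≤ δ₁ → L ≤ ‖expTail δ (layer s δ) 0‖ := by
  have key : ∀ s : ℝ, s ^ 2 = 1 → ∃ δ₁ : ℝ, 0 < δ₁ ∧ δ₁ ≤ 1 ∧ ∀ δ : ℝ, 0 ≤ δ → δ ≤ δ₁ →
      ‖airyPrim 0‖ / 2 ≤ ‖expTail δ (layer s δ) 0‖ := by
    intro s hs
    have h0 : ‖expTail 0 (layer s 0) 0‖ = ‖airyPrim 0‖ := by
      rw [← norm_neg (airyPrim 0), ← expTail_zero_layer hs, norm_mul, norm_layerDir hs, one_mul]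
    have hpos : 0 < ‖airyPrim 0‖ := norm_pos_iff.2 airyPrim_zero_ne_zero
    have hev := (continuousWithinAt_expTail_layer hs).norm.eventually
      (lt_mem_nhds (a := ‖airyPrim 0‖ / 2) (by beta_reduce; rw [h0]; linarith))
    obtain ⟨ε, hε, h⟩ := Metric.mem_nhdsWithin_iff.1 hev
    refine ⟨min (ε / 2) 1, by positivity, min_le_right _ _, fun δ hδ0 hδ1 => ?_⟩
    refine le_of_lt (h ⟨?_, hδ0, hδ1.trans (min_le_right _ _)⟩)
    rw [Metric.mem_ball, Real.dist_eq, sub_zero, abs_of_nonneg hδ0]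
    linarith [hδ1.trans (min_le_left _ _)]
  obtain ⟨δ₁, h1, h1', h1''⟩ := key 1 (by norm_num)
  obtain ⟨δ₂, h2, h2', h2''⟩ := key (-1) (by norm_num)
  refine ⟨‖airyPrim 0‖ / 2, min δ₁ δ₂, half_pos (norm_pos_iff.2 airyPrim_zero_ne_zero),
    lt_min h1 h2, (min_le_left _ _).trans h1', ?_⟩
  rintro s δ (rfl | rfl) hδ0 hδ
  · exact h1'' δ hδ0 (hδ.trans (min_le_left _ _))
  · exact h2'' δ hδ0 (hδ.trans (min_le_right _ _))

/-! ### The radial operators on the layer -/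

lemma opH_eq {n : ℤ} {f f₁ f₂ : ℝ → ℂ} (h₁ : ∀ r ∈ Ici (1 : ℝ), HasDerivWithinAt f (f₁ r) (Ici 1) r)
    (h₂ : ∀ r ∈ Ici (1 : ℝ), HasDerivWithinAt f₁ (f₂ r) (Ici 1) r) {r : ℝ} (hr : 1 ≤ r) :
    opH n f r = -f₂ r - (1 / (r : ℂ)) * f₁ r + ((n : ℂ) ^ 2 / (r : ℂ) ^ 2) * f r := by
  have hu := uniqueDiffOn_Ici (1 : ℝ)
  have e1 : EqOn (derivWithin f (Ici 1)) f₁ (Ici 1) := fun r hr =>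
    (h₁ r hr).derivWithin (hu r hr)
  rw [opH, derivWithin_congr e1 (e1 hr), (h₂ r hr).derivWithin (hu r hr), e1 hr]

/-- The profile `G` of the stream function and its companions `F = G' + δ G`, the vorticity `W`
and `W' = W₁`, with the equations linking them and a common exponential bound. -/
structure LayerSystem (s δ K : ℝ) (W W₁ F G : ℝ → ℂ) : Prop where
  sign : s ^ 2 = 1
  nonneg : 0 ≤ δ
  le_one : δ ≤ 1
  derivG : ∀ ρ, HasDerivAt G (F ρ - δ * G ρ) ρ
  derivF : ∀ ρ, HasDerivAt F (δ * F ρ - W ρ) ρ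
  derivW : ∀ ρ, HasDerivAt W (W₁ ρ) ρ
  derivW₁ : ∀ ρ, HasDerivAt W₁ ((δ ^ 2 - s * ρ * Complex.I) * W ρ) ρ
  smoothG : ContDiff ℝ ∞ G
  smoothF : ContDiff ℝ ∞ F
  smoothW : ContDiff ℝ ∞ W
  smoothW₁ : ContDiff ℝ ∞ W₁
  boundG : ExpBounded K G
  boundF : ExpBounded K F
  boundW : ExpBounded K W
  boundW₁ : ExpBounded K W₁

/-- The subleading part of the vorticity: `H_n φ = β² W + β corr` for `φ(r) = G(β(r - 1))`. -/
noncomputable def corr (δ β : ℝ) (F G : ℝ → ℂ) (r : ℝ) : ℂ :=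
  -(δ ^ 2 * β * (1 - (r : ℂ)⁻¹ ^ 2)) * G (β * (r - 1)) -
    (r : ℂ)⁻¹ * (F (β * (r - 1)) - δ * G (β * (r - 1)))

/-- The derivative of `corr`. -/
noncomputable def corrDeriv (δ β : ℝ) (W F G : ℝ → ℂ) (r : ℝ) : ℂ :=
  -(2 * δ ^ 2 * β * (r : ℂ)⁻¹ ^ 3) * G (β * (r - 1)) -
    δ ^ 2 * β ^ 2 * (1 - (r : ℂ)⁻¹ ^ 2) * (F (β * (r - 1)) - δ * G (β * (r - 1))) +
    (r : ℂ)⁻¹ ^ 2 * (F (β * (r - 1)) - δ * G (β * (r - 1))) -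
    β * (r : ℂ)⁻¹ * (δ ^ 2 * G (β * (r - 1)) - W (β * (r - 1)))

/-- The part of `r A_n H_n φ` that is not a derivative of a decaying explicit function. In terms of
`ρ = β(r - 1)` it has size `β³`, because `W` solves the leading-order equation. -/
noncomputable def residual (s δ β : ℝ) (W W₁ F G : ℝ → ℂ) (r : ℝ) : ℂ :=
  β ^ 3 * (δ ^ 2 * (r : ℂ)⁻¹ - s * β / 2 * (r - (r : ℂ)⁻¹) * Complex.I) * corr δ β F G r -
    β ^ 3 * W₁ (β * (r - 1)) -
    β ^ 4 * (δ ^ 2 * (r - (r : ℂ)⁻¹) -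
      s * β / 2 * ((r - 1) ^ 2 * (2 + (r : ℂ)⁻¹)) * Complex.I) * W (β * (r - 1))

/-- The function `g` with `A_n H_n φ = r⁻¹ (r g)'`. -/
noncomputable def forcing (s δ β : ℝ) (W W₁ F G : ℝ → ℂ) (r : ℝ) : ℂ :=
  -(β * corrDeriv δ β W F G r) - (r : ℂ)⁻¹ * ∫ t in Ioi r, residual s δ β W W₁ F G t

section

variable {s δ K β : ℝ} {W W₁ F G : ℝ → ℂ}

lemma hasDerivAt_comp_scaled {f : ℝ → ℂ} {f' : ℂ} {r : ℝ} (h : HasDerivAt f f' (β * (r - 1))) :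
    HasDerivAt (fun r : ℝ => f (β * (r - 1))) (β * f') r := by
  have h1 : HasDerivAt (fun r : ℝ => β * (r - 1)) β r := by
    simpa using ((hasDerivAt_id r).sub_const 1).const_mul β
  exact (h.scomp r h1).congr_deriv (by simp)

lemma hasDerivAt_ofReal_inv {r : ℝ} (hr : r ≠ 0) :
    HasDerivAt (fun r : ℝ => (r : ℂ)⁻¹) (-(r : ℂ)⁻¹ ^ 2) r := by
  have h := (hasDerivAt_inv (x := (r : ℂ)) (by exact_mod_cast hr)).comp_ofReal
  exact h.congr_deriv (by rw [inv_pow])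

lemma LayerSystem.hasDerivAt_corr (h : LayerSystem s δ K W W₁ F G) {r : ℝ} (hr : r ≠ 0) :
    HasDerivAt (corr δ β F G) (corrDeriv δ β W F G r) r := by
  have hi := hasDerivAt_ofReal_inv hr
  have hG := hasDerivAt_comp_scaled (h.derivG (β * (r - 1)))
  have hF := hasDerivAt_comp_scaled (h.derivF (β * (r - 1)))
  refine ((((((hi.pow 2).const_sub 1).const_mul ((δ : ℂ) ^ 2 * β)).neg).mul hG).sub
    (hi.mul (hF.sub (hG.const_mul (δ : ℂ))))).congr_deriv ?_
  simp only [corrDeriv, Pi.pow_apply, Pi.neg_apply, Pi.sub_apply]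
  push_cast
  ring

lemma contDiffOn_ofReal_inv : ContDiffOn ℝ ∞ (fun r : ℝ => (r : ℂ)⁻¹) (Ioi 0) :=
  contDiff_ofReal.contDiffOn.inv fun r hr => by exact_mod_cast (ne_of_gt hr)

lemma contDiff_comp_scaled {f : ℝ → ℂ} (hf : ContDiff ℝ ∞ f) :
    ContDiff ℝ ∞ fun r : ℝ => f (β * (r - 1)) := by fun_prop

lemma LayerSystem.contDiffOn_corr (h : LayerSystem s δ K W W₁ F G) :
    ContDiffOn ℝ ∞ (corr δ β F G) (Ioi 0) := by
  have hi := contDiffOn_ofReal_inv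
  have hG := (contDiff_comp_scaled (β := β) h.smoothG).contDiffOn (s := Ioi 0)
  have hF := (contDiff_comp_scaled (β := β) h.smoothF).contDiffOn (s := Ioi 0)
  exact ((contDiffOn_const.mul (contDiffOn_const.sub (hi.pow 2))).neg.mul hG).sub
    (hi.mul (hF.sub (contDiffOn_const.mul hG)))

lemma LayerSystem.contDiffOn_corrDeriv (h : LayerSystem s δ K W W₁ F G) :
    ContDiffOn ℝ ∞ (corrDeriv δ β W F G) (Ioi 0) := by
  have hi := contDiffOn_ofReal_inv
  have hG := (contDiff_comp_scaled (β := β) h.smoothG).contDiffOn (s := Ioi 0)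
  have hF := (contDiff_comp_scaled (β := β) h.smoothF).contDiffOn (s := Ioi 0)
  have hW := (contDiff_comp_scaled (β := β) h.smoothW).contDiffOn (s := Ioi 0)
  have hGF := hF.sub (contDiffOn_const (c := (δ : ℂ)).mul hG)
  exact ((((contDiffOn_const.mul (hi.pow 3)).neg.mul hG).sub
    ((contDiffOn_const.mul (contDiffOn_const.sub (hi.pow 2))).mul hGF)).add
    ((hi.pow 2).mul hGF)).sub ((contDiffOn_const.mul hi).mul ((contDiffOn_const.mul hG).sub hW))

lemma LayerSystem.contDiffOn_residual (h : LayerSystem s δ K W W₁ F G) :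
    ContDiffOn ℝ ∞ (residual s δ β W W₁ F G) (Ioi 0) := by
  have hi := contDiffOn_ofReal_inv
  have hr := contDiff_ofReal.contDiffOn (s := Ioi 0)
  have hc := h.contDiffOn_corr (β := β)
  have hW := (contDiff_comp_scaled (β := β) h.smoothW).contDiffOn (s := Ioi 0)
  have hW1 := (contDiff_comp_scaled (β := β) h.smoothW₁).contDiffOn (s := Ioi 0)
  exact ((((contDiffOn_const.mul ((contDiffOn_const.mul hi).sub
    ((contDiffOn_const.mul (hr.sub hi)).mul contDiffOn_const))).mul hc).sub
    (contDiffOn_const.mul hW1)).sub ((contDiffOn_const.mul ((contDiffOn_const.mul (hr.sub hi)).sub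
      ((contDiffOn_const.mul (((hr.sub contDiffOn_const).pow 2).mul
        (contDiffOn_const.add hi))).mul contDiffOn_const))).mul hW))

/-! ### Size of the forcing -/

lemma norm_ofReal_inv_le {r : ℝ} (hr : 1 ≤ r) : ‖(r : ℂ)⁻¹‖ ≤ 1 := by
  rw [norm_inv, Complex.norm_real, Real.norm_of_nonneg (by linarith)]
  exact inv_le_one_of_one_le₀ hr

lemma norm_one_sub_inv_sq_le {r : ℝ} (hr : 1 ≤ r) : ‖1 - (r : ℂ)⁻¹ ^ 2‖ ≤ 2 * (r - 1) := by
  have h : (1 - (r : ℂ)⁻¹ ^ 2) = ((1 - r⁻¹ ^ 2 : ℝ) : ℂ) := by push_cast; ring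
  have h1 : r⁻¹ ≤ 1 := inv_le_one_of_one_le₀ hr
  have h2 : r * r⁻¹ = 1 := mul_inv_cancel₀ (by positivity)
  have h3 : 0 ≤ r⁻¹ := by positivity
  rw [h, Complex.norm_real, Real.norm_of_nonneg (by nlinarith)]
  nlinarith

lemma norm_sub_inv_le {r : ℝ} (hr : 1 ≤ r) : ‖(r : ℂ) - (r : ℂ)⁻¹‖ ≤ 2 * (r - 1) := by
  have h : ((r : ℂ) - (r : ℂ)⁻¹) = ((r - r⁻¹ : ℝ) : ℂ) := by push_cast; ring
  have h1 : r⁻¹ ≤ 1 := inv_le_one_of_one_le₀ hr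
  have h2 : r * r⁻¹ = 1 := mul_inv_cancel₀ (by positivity)
  have h3 : 0 ≤ r⁻¹ := by positivity
  rw [h, Complex.norm_real, Real.norm_of_nonneg (by linarith)]
  nlinarith

lemma norm_ofReal_of_nonneg {x : ℝ} (hx : 0 ≤ x) : ‖(x : ℂ)‖ = x := by
  rw [Complex.norm_real, Real.norm_of_nonneg hx]

lemma LayerSystem.norm_sub_le (h : LayerSystem s δ K W W₁ F G) {ρ : ℝ} (hρ : 0 ≤ ρ) :
    ‖F ρ - δ * G ρ‖ ≤ 2 * (K * Real.exp (-4 * ρ)) := by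
  refine (_root_.norm_sub_le _ _).trans ?_
  rw [norm_mul, norm_ofReal_of_nonneg h.nonneg]
  have h1 := mul_le_mul h.le_one (h.boundG ρ hρ) (norm_nonneg _) zero_le_one
  linarith [h.boundF ρ hρ]

lemma LayerSystem.norm_corr_le (h : LayerSystem s δ K W W₁ F G) (hβ : 1 ≤ β) {r : ℝ}
    (hr : 1 ≤ r) : ‖corr δ β F G r‖ ≤
      2 * (1 + β * (r - 1)) * (K * Real.exp (-4 * (β * (r - 1)))) := by
  have hρ : 0 ≤ β * (r - 1) := mul_nonneg (by linarith) (by linarith)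
  have hδ2 : δ ^ 2 ≤ 1 := pow_le_one₀ h.nonneg h.le_one
  refine (_root_.norm_sub_le _ _).trans ?_
  have h1 : ‖-((δ : ℂ) ^ 2 * β * (1 - (r : ℂ)⁻¹ ^ 2)) * G (β * (r - 1))‖ ≤
      (1 * β * (2 * (r - 1))) * (K * Real.exp (-4 * (β * (r - 1)))) := by
    rw [norm_mul, norm_neg, norm_mul, norm_mul, norm_pow, norm_ofReal_of_nonneg h.nonneg,
      norm_ofReal_of_nonneg (by linarith : 0 ≤ β)]
    gcongr
    · exact norm_one_sub_inv_sq_le hr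
    · exact h.boundG _ hρ
  have h2 : ‖(r : ℂ)⁻¹ * (F (β * (r - 1)) - δ * G (β * (r - 1)))‖ ≤
      1 * (2 * (K * Real.exp (-4 * (β * (r - 1))))) := by
    rw [norm_mul]
    gcongr
    · exact norm_ofReal_inv_le hr
    · exact h.norm_sub_le hρ
  linarith

/-- Each factor `1 + ρ` costs one unit of the exponential rate. -/
lemma one_add_sq_mul_exp_le {ρ : ℝ} (hρ : 0 ≤ ρ) :
    (1 + ρ) ^ 2 * Real.exp (-4 * ρ) ≤ Real.exp (-2 * ρ) := by
  calc (1 + ρ) ^ 2 * Real.exp (-4 * ρ) ≤ Real.exp ρ ^ 2 * Real.exp (-4 * ρ) := by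
        gcongr
        linarith [Real.add_one_le_exp ρ]
    _ = Real.exp (-2 * ρ) := by
        rw [← Real.exp_nat_mul, ← Real.exp_add]
        congr 1
        push_cast
        ring

lemma LayerSystem.norm_corrDeriv_le (h : LayerSystem s δ K W W₁ F G) (hβ : 1 ≤ β) {r : ℝ}
    (hr : 1 ≤ r) : ‖corrDeriv δ β W F G r‖ ≤ 6 * β * (K * Real.exp (-2 * (β * (r - 1)))) := by
  have hρ : 0 ≤ β * (r - 1) := mul_nonneg (by linarith) (by linarith)
  have hδ2 : δ ^ 2 ≤ 1 := pow_le_one₀ h.nonneg h.le_one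
  have hβ0 : 0 ≤ β := by linarith
  have hK := h.boundG.nonneg
  set E := K * Real.exp (-4 * (β * (r - 1))) with hE
  have hE0 : 0 ≤ E := mul_nonneg hK (Real.exp_nonneg _)
  have hsub := h.norm_sub_le hρ
  have hinv := norm_ofReal_inv_le hr
  have h1 : ‖-(2 * (δ : ℂ) ^ 2 * β * (r : ℂ)⁻¹ ^ 3) * G (β * (r - 1))‖ ≤
      (2 * 1 * β * 1 ^ 3) * E := by
    rw [norm_mul, norm_neg, norm_mul, norm_mul, norm_mul, norm_pow, norm_pow,
      norm_ofReal_of_nonneg h.nonneg, norm_ofReal_of_nonneg hβ0, Complex.norm_ofNat]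
    gcongr
    exact h.boundG _ hρ
  have h2 : ‖(δ : ℂ) ^ 2 * β ^ 2 * (1 - (r : ℂ)⁻¹ ^ 2) *
      (F (β * (r - 1)) - δ * G (β * (r - 1)))‖ ≤ (1 * β ^ 2 * (2 * (r - 1))) * (2 * E) := by
    rw [norm_mul, norm_mul, norm_mul, norm_pow, norm_pow,
      norm_ofReal_of_nonneg h.nonneg, norm_ofReal_of_nonneg hβ0]
    gcongr
    exact norm_one_sub_inv_sq_le hr
  have h3 : ‖(r : ℂ)⁻¹ ^ 2 * (F (β * (r - 1)) - δ * G (β * (r - 1)))‖ ≤ 1 ^ 2 * (2 * E) := by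
    rw [norm_mul, norm_pow]
    gcongr
  have h4 : ‖(β : ℂ) * (r : ℂ)⁻¹ * (δ ^ 2 * G (β * (r - 1)) - W (β * (r - 1)))‖ ≤
      β * 1 * (1 * E + E) := by
    rw [norm_mul, norm_mul, norm_ofReal_of_nonneg hβ0]
    gcongr
    refine (_root_.norm_sub_le _ _).trans ?_
    rw [norm_mul, norm_pow, norm_ofReal_of_nonneg h.nonneg]
    gcongr
    · exact h.boundG _ hρ
    · exact h.boundW _ hρ
  have h5 : ‖corrDeriv δ β W F G r‖ ≤ (2 * 1 * β * 1 ^ 3) * E +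
      (1 * β ^ 2 * (2 * (r - 1))) * (2 * E) + 1 ^ 2 * (2 * E) + β * 1 * (1 * E + E) := by
    refine (_root_.norm_sub_le _ _).trans (add_le_add ?_ h4)
    refine (norm_add_le _ _).trans (add_le_add ?_ h3)
    exact (_root_.norm_sub_le _ _).trans (add_le_add h1 h2)
  have h6 := mul_le_mul_of_nonneg_left (one_add_sq_mul_exp_le hρ) hK
  have h7 : (1 + β * (r - 1)) ^ 2 * E ≤ K * Real.exp (-2 * (β * (r - 1))) := by
    rw [hE]
    linarith
  have h8 : (2 * 1 * β * 1 ^ 3) * E +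
      (1 * β ^ 2 * (2 * (r - 1))) * (2 * E) + 1 ^ 2 * (2 * E) + β * 1 * (1 * E + E) =
      (4 * β + 4 * β * (β * (r - 1)) + 2) * E := by ring
  rw [h8] at h5
  have h9 : 4 * β + 4 * β * (β * (r - 1)) + 2 ≤ 6 * β * (1 + β * (r - 1)) ^ 2 := by
    nlinarith [mul_nonneg hβ0 hρ, mul_nonneg hβ0 (sq_nonneg (β * (r - 1)))]
  calc ‖corrDeriv δ β W F G r‖ ≤ (6 * β * (1 + β * (r - 1)) ^ 2) * E :=
        h5.trans (mul_le_mul_of_nonneg_right h9 hE0)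
    _ = 6 * β * ((1 + β * (r - 1)) ^ 2 * E) := by ring
    _ ≤ _ := mul_le_mul_of_nonneg_left h7 (by linarith)

lemma LayerSystem.norm_residual_le (h : LayerSystem s δ K W W₁ F G) (hβ : 1 ≤ β) {r : ℝ}
    (hr : 1 ≤ r) : ‖residual s δ β W W₁ F G r‖ ≤
      4 * β ^ 3 * K * Real.exp (-2 * (β * (r - 1))) := by
  have hr0 : 0 ≤ r - 1 := by linarith
  have hρ : 0 ≤ β * (r - 1) := mul_nonneg (by linarith) hr0
  have hδ2 : δ ^ 2 ≤ 1 := pow_le_one₀ h.nonneg h.le_one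
  have hβ0 : 0 ≤ β := by linarith
  have hK := h.boundG.nonneg
  have hs : ‖(s : ℂ)‖ = 1 := by
    rw [Complex.norm_real, Real.norm_eq_abs, ← sq_eq_sq₀ (abs_nonneg _) zero_le_one, sq_abs,
      one_pow, h.sign]
  set E := K * Real.exp (-4 * (β * (r - 1))) with hE
  have hE0 : 0 ≤ E := mul_nonneg hK (Real.exp_nonneg _)
  have hinv := norm_ofReal_inv_le hr
  have hsub := norm_sub_inv_le hr
  have h1 : ‖(β : ℂ) ^ 3 * (δ ^ 2 * (r : ℂ)⁻¹ - s * β / 2 * (r - (r : ℂ)⁻¹) * Complex.I) *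
      corr δ β F G r‖ ≤ β ^ 3 * (1 * 1 + 1 * β / 2 * (2 * (r - 1)) * 1) *
        (2 * (1 + β * (r - 1)) * E) := by
    rw [norm_mul, norm_mul, norm_pow, norm_ofReal_of_nonneg hβ0]
    gcongr
    · refine (_root_.norm_sub_le _ _).trans ?_
      simp only [norm_mul, norm_pow, norm_div, hs, norm_ofReal_of_nonneg h.nonneg,
        norm_ofReal_of_nonneg hβ0, Complex.norm_I, Complex.norm_ofNat]
      gcongr
    · exact h.norm_corr_le hβ hr
  have h2 : ‖(β : ℂ) ^ 3 * W₁ (β * (r - 1))‖ ≤ β ^ 3 * E := by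
    rw [norm_mul, norm_pow, norm_ofReal_of_nonneg hβ0]
    gcongr
    exact h.boundW₁ _ hρ
  have hr1 : ‖(r : ℂ) - 1‖ = r - 1 := by
    rw [← Complex.ofReal_one, ← Complex.ofReal_sub, norm_ofReal_of_nonneg hr0]
  have h3i : ‖2 + (r : ℂ)⁻¹‖ ≤ 3 := by
    refine (norm_add_le _ _).trans ?_
    rw [Complex.norm_ofNat]
    linarith
  have h3 : ‖(β : ℂ) ^ 4 * (δ ^ 2 * (r - (r : ℂ)⁻¹) -
      s * β / 2 * ((r - 1) ^ 2 * (2 + (r : ℂ)⁻¹)) * Complex.I) * W (β * (r - 1))‖ ≤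
      β ^ 4 * (1 * (2 * (r - 1)) + 1 * β / 2 * ((r - 1) ^ 2 * 3) * 1) * E := by
    rw [norm_mul, norm_mul, norm_pow, norm_ofReal_of_nonneg hβ0]
    gcongr
    · refine (_root_.norm_sub_le _ _).trans ?_
      simp only [norm_mul, norm_pow, norm_div, hs, norm_ofReal_of_nonneg h.nonneg,
        norm_ofReal_of_nonneg hβ0, Complex.norm_I, Complex.norm_ofNat, hr1]
      gcongr
    · exact h.boundW _ hρ
  have h4 : ‖residual s δ β W W₁ F G r‖ ≤ β ^ 3 * (1 * 1 + 1 * β / 2 * (2 * (r - 1)) * 1) *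
        (2 * (1 + β * (r - 1)) * E) + β ^ 3 * E +
      β ^ 4 * (1 * (2 * (r - 1)) + 1 * β / 2 * ((r - 1) ^ 2 * 3) * 1) * E := by
    refine (_root_.norm_sub_le _ _).trans (add_le_add ?_ h3)
    exact (_root_.norm_sub_le _ _).trans (add_le_add h1 h2)
  have h6 := mul_le_mul_of_nonneg_left (one_add_sq_mul_exp_le hρ) hK
  calc ‖residual s δ β W W₁ F G r‖ ≤ β ^ 3 * E * (2 * (1 + β * (r - 1)) ^ 2 + 1 +
        2 * (β * (r - 1)) + 3 / 2 * (β * (r - 1)) ^ 2) := h4.trans (le_of_eq (by ring))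
    _ ≤ β ^ 3 * E * (4 * (1 + β * (r - 1)) ^ 2) := by
        refine mul_le_mul_of_nonneg_left ?_ (by positivity)
        nlinarith [sq_nonneg (β * (r - 1))]
    _ = 4 * β ^ 3 * (K * ((1 + β * (r - 1)) ^ 2 * Real.exp (-4 * (β * (r - 1))))) := by
        rw [hE]
        ring
    _ ≤ 4 * β ^ 3 * (K * Real.exp (-2 * (β * (r - 1)))) :=
        mul_le_mul_of_nonneg_left h6 (by positivity)
    _ = _ := by ring

lemma exp_scaled_eq (c β r : ℝ) :
    Real.exp (-c * (β * (r - 1))) = Real.exp (c * β) * Real.exp (-(c * β) * r) := by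
  rw [← Real.exp_add]
  congr 1
  ring

lemma integrableOn_exp_scaled {c : ℝ} (hc : 0 < c) (hβ : 1 ≤ β) (a : ℝ) :
    IntegrableOn (fun r : ℝ => Real.exp (-c * (β * (r - 1)))) (Ioi a) := by
  simp only [exp_scaled_eq c β]
  exact (integrableOn_exp_mul_Ioi (neg_neg_of_pos (by positivity)) a).const_mul _

lemma integral_exp_scaled {c : ℝ} (hc : 0 < c) (hβ : 1 ≤ β) (a : ℝ) :
    ∫ r in Ioi a, Real.exp (-c * (β * (r - 1))) = Real.exp (-c * (β * (a - 1))) / (c * β) := by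
  simp only [exp_scaled_eq c β]
  rw [integral_const_mul, integral_exp_mul_Ioi (neg_neg_of_pos (by positivity)), neg_div_neg_eq,
    mul_div_assoc]

lemma LayerSystem.integrableOn_residual (h : LayerSystem s δ K W W₁ F G) (hβ : 1 ≤ β) {x : ℝ}
    (hx : 0 < x) : IntegrableOn (residual s δ β W W₁ F G) (Ioi x) := by
  have hc := (h.contDiffOn_residual (β := β)).continuousOn
  have h1 : IntegrableOn (residual s δ β W W₁ F G) (Ioi 1) := by
    refine ((integrableOn_exp_scaled (c := 2) two_pos hβ 1).const_mul (4 * β ^ 3 * K)).mono'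
      ((hc.mono (Ioi_subset_Ioi zero_le_one)).aestronglyMeasurable measurableSet_Ioi) ?_
    exact (ae_restrict_iff' measurableSet_Ioi).2 (ae_of_all _ fun r hr =>
      h.norm_residual_le hβ (le_of_lt hr))
  have h2 : IntegrableOn (residual s δ β W W₁ F G) (Icc x 1) :=
    (hc.mono fun r hr => hx.trans_le hr.1).integrableOn_Icc
  refine (h2.union h1).mono_set fun r hr => ?_
  rcases le_or_gt r 1 with h' | h'
  · exact Or.inl ⟨le_of_lt hr, h'⟩
  · exact Or.inr h'

lemma LayerSystem.contDiffOn_forcing (h : LayerSystem s δ K W W₁ F G) (hβ : 1 ≤ β) :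
    ContDiffOn ℝ ∞ (forcing s δ β W W₁ F G) (Ioi 0) :=
  (contDiffOn_const.mul h.contDiffOn_corrDeriv).neg.sub (contDiffOn_ofReal_inv.mul
    (contDiffOn_integral_Ioi h.contDiffOn_residual fun _ hx => h.integrableOn_residual hβ hx))

lemma LayerSystem.norm_forcing_le (h : LayerSystem s δ K W W₁ F G) (hβ : 1 ≤ β) {r : ℝ}
    (hr : 1 ≤ r) : ‖forcing s δ β W W₁ F G r‖ ≤
      8 * β ^ 2 * K * Real.exp (-2 * (β * (r - 1))) := by
  have hβ0 : 0 < β := by linarith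
  have h1 : ‖-((β : ℂ) * corrDeriv δ β W F G r)‖ ≤
      β * (6 * β * (K * Real.exp (-2 * (β * (r - 1))))) := by
    rw [norm_neg, norm_mul, norm_ofReal_of_nonneg hβ0.le]
    exact mul_le_mul_of_nonneg_left (h.norm_corrDeriv_le hβ hr) hβ0.le
  have h2 : ‖∫ t in Ioi r, residual s δ β W W₁ F G t‖ ≤
      4 * β ^ 3 * K * (Real.exp (-2 * (β * (r - 1))) / (2 * β)) := by
    rw [← integral_exp_scaled two_pos hβ, ← integral_const_mul]
    refine norm_integral_le_of_norm_le ((integrableOn_exp_scaled two_pos hβ r).const_mul _) ?_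
    exact (ae_restrict_iff' measurableSet_Ioi).2 (ae_of_all _ fun t ht =>
      h.norm_residual_le hβ (hr.trans (le_of_lt ht)))
  have h3 : ‖(r : ℂ)⁻¹ * ∫ t in Ioi r, residual s δ β W W₁ F G t‖ ≤
      1 * (4 * β ^ 3 * K * (Real.exp (-2 * (β * (r - 1))) / (2 * β))) := by
    rw [norm_mul]
    exact mul_le_mul (norm_ofReal_inv_le hr) h2 (norm_nonneg _) zero_le_one
  refine (_root_.norm_sub_le _ _).trans ((add_le_add h1 h3).trans (le_of_eq ?_))
  field_simp
  ring

lemma LayerSystem.norm_forcing_sq_mul_le (h : LayerSystem s δ K W W₁ F G) (hβ : 1 ≤ β) {r : ℝ}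
    (hr : 1 ≤ r) : ‖forcing s δ β W W₁ F G r‖ ^ 2 * r ≤
      (8 * β ^ 2 * K) ^ 2 * Real.exp (-1 * (β * (r - 1))) := by
  have hr' : r ≤ Real.exp (β * (r - 1)) := by
    have := Real.add_one_le_exp (β * (r - 1))
    nlinarith
  calc ‖forcing s δ β W W₁ F G r‖ ^ 2 * r
      ≤ (8 * β ^ 2 * K * Real.exp (-2 * (β * (r - 1)))) ^ 2 * Real.exp (β * (r - 1)) := by
        gcongr
        exact h.norm_forcing_le hβ hr
    _ = (8 * β ^ 2 * K) ^ 2 * Real.exp (-3 * (β * (r - 1))) := by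
        rw [mul_pow, ← Real.exp_nat_mul, mul_assoc, ← Real.exp_add]
        congr 2
        push_cast
        ring
    _ ≤ _ := by
        have : 0 ≤ β * (r - 1) := mul_nonneg (by linarith) (by linarith)
        gcongr
        norm_num

lemma LayerSystem.memL2_forcing (h : LayerSystem s δ K W W₁ F G) (hβ : 1 ≤ β) :
    MemL2 (forcing s δ β W W₁ F G) := by
  have hc : ContinuousOn (forcing s δ β W W₁ F G) (Ioi 1) :=
    (h.contDiffOn_forcing hβ).continuousOn.mono (Ioi_subset_Ioi zero_le_one)
  refine ⟨hc.aestronglyMeasurable measurableSet_Ioi, ?_⟩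
  refine ((integrableOn_exp_scaled one_pos hβ 1).const_mul ((8 * β ^ 2 * K) ^ 2)).mono'
    (((hc.norm.pow 2).mul continuousOn_id).aestronglyMeasurable measurableSet_Ioi) ?_
  refine (ae_restrict_iff' measurableSet_Ioi).2 (ae_of_all _ fun r hr => ?_)
  have hr1 : 1 ≤ r := le_of_lt hr
  rw [Real.norm_of_nonneg (by positivity)]
  exact h.norm_forcing_sq_mul_le hβ hr1

lemma LayerSystem.normL2_forcing_le (h : LayerSystem s δ K W W₁ F G) (hβ : 1 ≤ β) :
    normL2 (forcing s δ β W W₁ F G) ≤ 24 * K * β ^ ((3 : ℝ) / 2) := by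
  have hβ0 : 0 < β := by linarith
  have hK := h.boundG.nonneg
  have h1 : ∫ r in Ioi (1 : ℝ), ‖forcing s δ β W W₁ F G r‖ ^ 2 * r ≤
      (8 * β ^ 2 * K) ^ 2 * (1 / β) := by
    have h2 := setIntegral_mono_on (h.memL2_forcing hβ).2
      ((integrableOn_exp_scaled one_pos hβ 1).const_mul ((8 * β ^ 2 * K) ^ 2)) measurableSet_Ioi
      fun r hr => h.norm_forcing_sq_mul_le hβ (le_of_lt hr)
    rw [integral_const_mul, integral_exp_scaled one_pos hβ] at h2
    simpa using h2
  rw [normL2, Real.sqrt_le_left (by positivity), mul_pow, ← Real.rpow_natCast (β ^ _),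
    ← Real.rpow_mul hβ0.le]
  have h3 : β ^ ((3 : ℝ) / 2 * ((2 : ℕ) : ℝ)) = β ^ 3 := by
    rw [← Real.rpow_natCast]
    norm_num
  rw [h3]
  have hpi : 2 * Real.pi ≤ 9 := by linarith [Real.pi_lt_four]
  calc 2 * Real.pi * ∫ r in Ioi (1 : ℝ), ‖forcing s δ β W W₁ F G r‖ ^ 2 * r
      ≤ 9 * ((8 * β ^ 2 * K) ^ 2 * (1 / β)) := by
        refine mul_le_mul hpi h1 (integral_nonneg_of_ae ?_) (by norm_num)
        refine (ae_restrict_iff' measurableSet_Ioi).2 (ae_of_all _ fun r hr => ?_)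
        have hr1 : 0 < r := zero_lt_one.trans hr
        exact mul_nonneg (sq_nonneg _) hr1.le
    _ = (24 * K) ^ 2 * β ^ 3 := by
        field_simp
        ring

/-! ### The equation for the stream function -/

lemma LayerSystem.opH_stream (h : LayerSystem s δ K W W₁ F G) {n : ℤ}
    (hn : (n : ℝ) ^ 2 = δ ^ 2 * β ^ 2) {r : ℝ} (hr : 1 ≤ r) :
    opH n (fun r => G (β * (r - 1))) r =
      β ^ 2 * W (β * (r - 1)) + β * corr δ β F G r := by
  have hr0 : (r : ℂ) ≠ 0 := by exact_mod_cast (by linarith : r ≠ 0)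
  have hn' : (n : ℂ) ^ 2 = δ ^ 2 * β ^ 2 := by exact_mod_cast congrArg (fun x : ℝ => (x : ℂ)) hn
  have hG := fun r : ℝ => hasDerivAt_comp_scaled (β := β) (h.derivG (β * (r - 1)))
  have hF := fun r : ℝ => hasDerivAt_comp_scaled (β := β) (h.derivF (β * (r - 1)))
  rw [opH_eq (f₁ := fun r => β * (F (β * (r - 1)) - δ * G (β * (r - 1))))
    (fun r _ => (hG r).hasDerivWithinAt)
    (fun r _ => (((hF r).sub ((hG r).const_mul (δ : ℂ))).const_mul (β : ℂ)).hasDerivWithinAt) hr,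
    hn', corr]
  field_simp
  ring

lemma LayerSystem.opA_opH_stream (h : LayerSystem s δ K W W₁ F G) (hβ : 1 ≤ β) {n : ℤ} {α : ℝ}
    (hn : (n : ℝ) ^ 2 = δ ^ 2 * β ^ 2) (hα : α * n = s * β ^ 3 / 2) {r : ℝ} (hr : 1 ≤ r) :
    opA n α (opH n fun r => G (β * (r - 1))) r = (1 / (r : ℂ)) *
      derivWithin (fun t : ℝ => (t : ℂ) * forcing s δ β W W₁ F G t) (Ici 1) r := by
  have hne : ∀ t : ℝ, 1 ≤ t → t ≠ 0 := fun t ht => by linarith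
  have hr0 : (r : ℂ) ≠ 0 := by exact_mod_cast hne r hr
  have hn' : (n : ℂ) ^ 2 = δ ^ 2 * β ^ 2 := by exact_mod_cast congrArg (fun x : ℝ => (x : ℂ)) hn
  have hα' : (α : ℂ) * n = s * β ^ 3 / 2 := by
    have := congrArg (fun x : ℝ => (x : ℂ)) hα
    push_cast at this
    exact this
  have hW := fun r : ℝ => hasDerivAt_comp_scaled (β := β) (h.derivW (β * (r - 1)))
  have hW1 := fun r : ℝ => hasDerivAt_comp_scaled (β := β) (h.derivW₁ (β * (r - 1)))
  -- the second derivative of `corr` enters both sides, so that its value is not needed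
  have hcd : ∀ t : ℝ, 1 ≤ t → HasDerivAt (corrDeriv δ β W F G)
      (deriv (corrDeriv δ β W F G) t) t := fun t ht =>
    ((h.contDiffOn_corrDeriv.contDiffAt (Ioi_mem_nhds (by linarith : 0 < t))).differentiableAt
      (by simp)).hasDerivAt
  have hv : EqOn (opH n fun r => G (β * (r - 1)))
      (fun r => β ^ 2 * W (β * (r - 1)) + β * corr δ β F G r) (Ici 1) :=
    fun t ht => h.opH_stream hn ht
  have hL : opH n (opH n fun r => G (β * (r - 1))) r = _ :=
    opH_eq (f₁ := fun r => β ^ 2 * (β * W₁ (β * (r - 1))) + β * corrDeriv δ β W F G r)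
    (fun t ht => (((hW t).const_mul ((β : ℂ) ^ 2)).add
      ((h.hasDerivAt_corr (β := β) (hne t ht)).const_mul (β : ℂ))).hasDerivWithinAt.congr hv
        (hv ht))
    (fun t ht => ((((hW1 t).const_mul (β : ℂ)).const_mul ((β : ℂ) ^ 2)).add
      ((hcd t ht).const_mul (β : ℂ))).hasDerivWithinAt) hr
  have hT := hasDerivAt_integral_Ioi (a := 0) (r := r)
    (h.contDiffOn_residual (β := β)).continuousOn
    (fun x hx => h.integrableOn_residual hβ hx) (by linarith)
  have hR : HasDerivAt (fun t : ℝ => (t : ℂ) * forcing s δ β W W₁ F G t)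
      (-(β * (corrDeriv δ β W F G r + r * deriv (corrDeriv δ β W F G) r)) +
        residual s δ β W W₁ F G r) r := by
    have hid : HasDerivAt (fun t : ℝ => (t : ℂ)) 1 r := Complex.ofRealCLM.hasDerivAt
    have h1 : HasDerivAt (fun t : ℝ => -((β : ℂ) * (t * corrDeriv δ β W F G t)) -
        ∫ x in Ioi t, residual s δ β W W₁ F G x) _ r :=
      (((hid.mul (hcd r hr)).const_mul (β : ℂ)).neg).sub hT
    refine (h1.congr_of_eventuallyEq ?_).congr_deriv (by ring)
    filter_upwards [Ioi_mem_nhds (by linarith : 0 < r)] with t ht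
    have ht0 : (t : ℂ) ≠ 0 := by exact_mod_cast (ne_of_gt ht)
    rw [forcing]
    field_simp
  rw [opA, hL, hv hr, hR.hasDerivWithinAt.derivWithin (uniqueDiffOn_Ici 1 r hr), residual, hn',
    mul_assoc Complex.I, hα']
  push_cast
  field_simp
  ring

end

/-! ### The Airy profile as a layer system -/

lemma ExpBounded.const_mul {K : ℝ} {f : ℝ → ℂ} (h : ExpBounded K f) {c : ℂ} (hc : ‖c‖ ≤ 1) :
    ExpBounded K fun ρ => c * f ρ := fun ρ hρ => by
  rw [norm_mul]
  exact (mul_le_of_le_one_left (norm_nonneg _) hc).trans (h ρ hρ)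

lemma contDiff_layerDeriv (s δ : ℝ) : ContDiff ℝ ∞ (layerDeriv s δ) := by
  have h : layerDeriv s δ = deriv (layer s δ) := funext fun ρ => (hasDerivAt_layer s δ ρ).deriv.symm
  rw [h]
  exact (contDiff_infty_iff_deriv.1 (contDiff_layer s δ)).2

lemma layerSystem_layer {s δ : ℝ} (hs : s ^ 2 = 1) (hδ0 : 0 ≤ δ) (hδ1 : δ ≤ 1) {c : ℂ}
    (hc : ‖c‖ ≤ 1) : LayerSystem s δ (Real.exp 100) (fun ρ => c * layer s δ ρ)
      (fun ρ => c * layerDeriv s δ ρ) (fun ρ => c * expTail δ (layer s δ) ρ)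
      (fun ρ => c * -expTail (-δ) (expTail δ (layer s δ)) ρ) := by
  have hδ : |δ| ≤ 1 := by rwa [abs_of_nonneg hδ0]
  have hδ' : |-δ| ≤ 1 := by rwa [abs_neg]
  have bW := expBounded_layer hs hδ
  have bF := bW.expTail hδ
  have bG := bF.expTail hδ'
  have cW := contDiff_layer s δ
  have cF := contDiff_expTail cW bW hδ
  have cG := contDiff_expTail cF bF hδ'
  refine ⟨hs, hδ0, hδ1, fun ρ => ?_, fun ρ => ?_, fun ρ => ?_, fun ρ => ?_,
    contDiff_const.mul cG.neg, contDiff_const.mul cF, contDiff_const.mul cW,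
    contDiff_const.mul (contDiff_layerDeriv s δ), ?_, bF.const_mul hc, bW.const_mul hc,
    (expBounded_layerDeriv hs hδ).const_mul hc⟩
  · refine ((hasDerivAt_expTail cF.continuous bF hδ' ρ).neg.const_mul c).congr_deriv ?_
    push_cast
    ring
  · exact ((hasDerivAt_expTail cW.continuous bW hδ ρ).const_mul c).congr_deriv (by ring)
  · exact (hasDerivAt_layer s δ ρ).const_mul c
  · exact ((hasDerivAt_layerDeriv hs δ ρ).const_mul c).congr_deriv (by ring)
  · refine ExpBounded.const_mul (fun ρ hρ => ?_) hc
    rw [norm_neg]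
    exact bG ρ hρ

/-- The first three derivatives of `G` are combinations of `G`, `F`, `W` and `W₁`. -/
lemma LayerSystem.exp_mul_norm_iteratedDerivWithin_le {s δ K : ℝ} {W W₁ F G : ℝ → ℂ}
    (h : LayerSystem s δ K W W₁ F G) {k : ℕ} (hk : k ≤ 3) {ρ : ℝ} (hρ : 0 ≤ ρ) :
    Real.exp ρ * ‖iteratedDerivWithin k G (Ici 0) ρ‖ ≤ 3 * K := by
  rw [iteratedDerivWithin_eq_iteratedDeriv (uniqueDiffOn_Ici 0)
    (h.smoothG.contDiffAt.of_le (by exact_mod_cast le_top)) hρ]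
  have hK := h.boundG.nonneg
  have hE : Real.exp ρ * Real.exp (-4 * ρ) ≤ 1 := by
    rw [← Real.exp_add, Real.exp_le_one_iff]
    linarith
  suffices hs : ‖iteratedDeriv k G ρ‖ ≤ 3 * (K * Real.exp (-4 * ρ)) by
    calc Real.exp ρ * ‖iteratedDeriv k G ρ‖ ≤ Real.exp ρ * (3 * (K * Real.exp (-4 * ρ))) := by
          gcongr
      _ = 3 * K * (Real.exp ρ * Real.exp (-4 * ρ)) := by ring
      _ ≤ 3 * K * 1 := by gcongr
      _ = 3 * K := mul_one _
  have hE0 : 0 ≤ K * Real.exp (-4 * ρ) := mul_nonneg hK (Real.exp_nonneg _)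
  have d1 : deriv G = fun ρ => F ρ - δ * G ρ := funext fun ρ => (h.derivG ρ).deriv
  have d2 : deriv (fun ρ => F ρ - δ * G ρ) = fun ρ => δ ^ 2 * G ρ - W ρ := funext fun ρ =>
    (((h.derivF ρ).sub ((h.derivG ρ).const_mul (δ : ℂ))).deriv).trans (by ring)
  have d3 : deriv (fun ρ => δ ^ 2 * G ρ - W ρ) = fun ρ => δ ^ 2 * (F ρ - δ * G ρ) - W₁ ρ :=
    funext fun ρ => (((h.derivG ρ).const_mul ((δ : ℂ) ^ 2)).sub (h.derivW ρ)).deriv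
  have hδ : ‖(δ : ℂ) ^ 2‖ ≤ 1 := by
    rw [norm_pow, norm_ofReal_of_nonneg h.nonneg]
    exact pow_le_one₀ h.nonneg h.le_one
  have hmul : ∀ z : ℂ, ‖(δ : ℂ) ^ 2 * z‖ ≤ ‖z‖ := fun z => by
    rw [norm_mul]
    exact mul_le_of_le_one_left (norm_nonneg _) hδ
  have hGρ := h.boundG ρ hρ
  have hFG := h.norm_sub_le hρ
  interval_cases k
  · rw [iteratedDeriv_zero]
    linarith
  · rw [iteratedDeriv_one, d1]
    linarith
  · rw [iteratedDeriv_succ, iteratedDeriv_one, d1, d2]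
    refine (_root_.norm_sub_le _ _).trans ?_
    linarith [hmul (G ρ), h.boundW ρ hρ]
  · rw [iteratedDeriv_succ, iteratedDeriv_succ, iteratedDeriv_one, d1, d2, d3]
    refine (_root_.norm_sub_le _ _).trans ?_
    linarith [hmul (F ρ - δ * G ρ), h.boundW₁ ρ hρ]

/-! ### Reduction to the parameters `s` and `δ` -/

/-- The sign of `α n`, as a number `±1`. -/
noncomputable def layerSign (n : ℤ) (α : ℝ) : ℝ := if 0 < α * (n : ℝ) then 1 else -1

lemma layerSign_eq (n : ℤ) (α : ℝ) : layerSign n α = 1 ∨ layerSign n α = -1 := by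
  unfold layerSign
  split_ifs <;> simp

lemma layerSign_mul (n : ℤ) (α : ℝ) : layerSign n α * |α * n| = α * n := by
  unfold layerSign
  split_ifs with h
  · rw [abs_of_pos h, one_mul]
  · rw [abs_of_nonpos (not_lt.1 h)]
    ring

lemma betaDir_eq (n : ℤ) (α : ℝ) : betaDir n α = layerDir (layerSign n α) := by
  unfold betaDir layerDir layerSign
  split_ifs <;> simp

lemma betaAbs_cube (n : ℤ) (α : ℝ) : betaAbs n α ^ 3 = 2 * |α * n| := by
  rw [betaAbs, ← Real.rpow_natCast, ← Real.rpow_mul (by positivity)]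
  norm_num

lemma airyLayer_eq {n : ℤ} {α : ℝ} (hβ : 0 < betaAbs n α) (hα : α ≠ 0) :
    airyLayer n α = layer (layerSign n α) (|(n : ℝ)| / betaAbs n α) := by
  funext ρ
  have hs2 : layerSign n α ^ 2 = 1 := by
    rcases layerSign_eq n α with h | h <;> rw [h] <;> norm_num
  have key : (n : ℝ) * betaAbs n α / (2 * α) =
      layerSign n α * (|(n : ℝ)| / betaAbs n α) ^ 2 := by
    rw [div_pow, sq_abs]
    field_simp
    rw [betaAbs_cube]
    linear_combination (2 * n * layerSign n α) * layerSign_mul n α - 2 * n * |α * n| * hs2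
  have keyC := congrArg (fun x : ℝ => (x : ℂ)) key
  push_cast at keyC
  rw [airyLayer, layer, layerPoint, betaDir_eq]
  congr 3
  push_cast
  linear_combination Complex.I * keyC

lemma airyProfile_eq {n : ℤ} {α : ℝ} (hβ : 0 < betaAbs n α) (hα : α ≠ 0) (ρ : ℝ) :
    airyProfile n α ρ = -expTail (-(|(n : ℝ)| / betaAbs n α))
      (expTail (|(n : ℝ)| / betaAbs n α)
        (layer (layerSign n α) (|(n : ℝ)| / betaAbs n α))) ρ := by
  rw [airyProfile, airyLayer_eq hβ hα]
  unfold expTail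
  congr 2
  funext τ
  congr 3
  ring

lemma norm_normFactor_le (n : ℤ) (α : ℝ) : ‖normFactor n α‖ ≤ 1 := by
  unfold normFactor
  split_ifs with h
  · rw [norm_div, norm_one]
    exact div_le_one_of_le₀ h (norm_nonneg _)
  · rw [norm_one]

lemma norm_normFactor_mul_le (n : ℤ) (α : ℝ) : ‖normFactor n α * airyProfile n α 0‖ ≤ 1 := by
  unfold normFactor
  split_ifs with h
  · have h0 : airyProfile n α 0 ≠ 0 := norm_pos_iff.1 (zero_lt_one.trans_le h)
    rw [one_div_mul_cancel h0, norm_one]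
  · rw [one_mul]
    exact (not_le.1 h).le

lemma inv_le_norm_normFactor {n : ℤ} {α K : ℝ} (hK1 : 1 ≤ K) (hK : ‖airyProfile n α 0‖ ≤ K) :
    K⁻¹ ≤ ‖normFactor n α‖ := by
  unfold normFactor
  split_ifs with h
  · rw [norm_div, norm_one, one_div]
    exact inv_anti₀ (zero_lt_one.trans_le h) hK
  · rw [norm_one]
    exact inv_le_one_of_one_le₀ hK1

/-- The smallness of `|n| / |α|^{1/2}` makes `δ = |n| / |β|` small: `δ³ = n² / (2|α|)`. -/
lemma abs_div_betaAbs_le {n : ℤ} {α κ δ₁ : ℝ} (hβ : 0 < betaAbs n α) (hδ₀ : 0 ≤ δ₁)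
    (hδ₁ : δ₁ ≤ 1) (hκ₀ : 0 ≤ κ) (hκ : κ ≤ δ₁ ^ 2) (hn : |(n : ℝ)| ≤ κ * √|α|) :
    |(n : ℝ)| / betaAbs n α ≤ δ₁ := by
  have hsq : |(n : ℝ)| ^ 2 ≤ κ ^ 2 * |α| := by
    calc |(n : ℝ)| ^ 2 ≤ (κ * √|α|) ^ 2 := by gcongr
      _ = κ ^ 2 * |α| := by rw [mul_pow, Real.sq_sqrt (abs_nonneg _)]
  have hκ2 : κ ^ 2 ≤ δ₁ ^ 3 := by
    calc κ ^ 2 ≤ (δ₁ ^ 2) ^ 2 := by gcongr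
      _ = δ₁ ^ 3 * δ₁ := by ring
      _ ≤ δ₁ ^ 3 := mul_le_of_le_one_right (by positivity) hδ₁
  have hn0 := abs_nonneg (n : ℝ)
  have hα0 := abs_nonneg α
  rw [← pow_le_pow_iff_left₀ (by positivity) hδ₀ three_ne_zero, div_pow, betaAbs_cube, abs_mul]
  refine div_le_of_le_mul₀ (by positivity) (by positivity) ?_
  calc |(n : ℝ)| ^ 3 = |(n : ℝ)| ^ 2 * |(n : ℝ)| := by ring
    _ ≤ (κ ^ 2 * |α|) * |(n : ℝ)| := by gcongr
    _ ≤ (δ₁ ^ 3 * |α|) * |(n : ℝ)| := by gcongr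
    _ ≤ δ₁ ^ 3 * (2 * (|α| * |(n : ℝ)|)) := by
        nlinarith [mul_nonneg (pow_nonneg hδ₀ 3) (mul_nonneg hα0 hn0)]

end BoundaryLayer

theorem mainTheorem7 :
    ∃ κ C B R M : ℝ, 0 < κ ∧ κ < 1 ∧ 0 < C ∧ 0 < B ∧ 0 < R ∧ 0 < M ∧
      ∀ (n : ℤ) (α : ℝ),
        |(n : ℝ)| ≤ κ * √|α| →
        B ≤ BoundaryLayer.betaAbs n α →
        ∃ φ g G : ℝ → ℂ,
          ContDiffOn ℝ ∞ φ (Ici 1) ∧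
          ContDiffOn ℝ ∞ g (Ici 1) ∧
          ContDiffOn ℝ ∞ G (Ici 0) ∧
          -- the equation, and the size of the error and of the boundary value
          (∀ r : ℝ, 1 ≤ r →
            BoundaryLayer.opA n α (BoundaryLayer.opH n φ) r =
              (1 / (r : ℂ)) * derivWithin (fun s : ℝ => (s : ℂ) * g s) (Ici 1) r) ∧
          BoundaryLayer.MemL2 g ∧
          BoundaryLayer.normL2 g ≤ C * BoundaryLayer.betaAbs n α ^ ((3 : ℝ) / 2) ∧
          ‖φ 1‖ ≤ 1 ∧
          -- nondegeneracy at the boundary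
          κ / 2 * BoundaryLayer.betaAbs n α ≤
            ‖derivWithin φ (Ici 1) 1 + ((|(n : ℝ)| : ℝ) : ℂ) * φ 1‖ ∧
          -- boundary layer structure, with the explicit Airy profile
          (∀ r : ℝ, 1 ≤ r → φ r = G (BoundaryLayer.betaAbs n α * (r - 1))) ∧
          (∀ ρ : ℝ, 0 ≤ ρ →
            G ρ = BoundaryLayer.normFactor n α * BoundaryLayer.airyProfile n α ρ) ∧
          -- exponential decay, uniformly in `n` and `α`
          (∀ k : ℕ, k ≤ 3 → ∀ ρ : ℝ, R ≤ ρ →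
            Real.exp ρ * ‖iteratedDerivWithin k G (Ici 0) ρ‖ ≤ M) := by
  obtain ⟨L, δ₁, hL, hδ₁, hδ₁', hlow⟩ := BoundaryLayer.exists_le_norm_expTail_layer
  have hK1 : 1 ≤ Real.exp 100 := Real.one_le_exp (by norm_num)
  -- `κ ≤ L / K` serves the lower bound at the boundary, `κ ≤ δ₁²` makes `δ ≤ δ₁`
  refine ⟨min (1 / 2) (min (L * (Real.exp 100)⁻¹) (δ₁ ^ 2)), 24 * Real.exp 100, 1, 1,
    3 * Real.exp 100, by positivity, (min_le_left _ _).trans_lt (by norm_num), by positivity,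
    one_pos, one_pos, by positivity, fun n α hn hβ => ?_⟩
  set κ := min (1 / 2) (min (L * (Real.exp 100)⁻¹) (δ₁ ^ 2))
  have hκ0 : 0 < κ := by positivity
  have hκL : κ ≤ L * (Real.exp 100)⁻¹ := (min_le_right _ _).trans (min_le_left _ _)
  have hκδ : κ ≤ δ₁ ^ 2 := (min_le_right _ _).trans (min_le_right _ _)
  have hβ0 : 0 < BoundaryLayer.betaAbs n α := one_pos.trans_le hβ
  have hcube := BoundaryLayer.betaAbs_cube n α
  have hα : α ≠ 0 := by
    rintro rfl
    rw [zero_mul, abs_zero, mul_zero] at hcube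
    exact (pow_pos hβ0 3).ne' hcube
  have hδle := BoundaryLayer.abs_div_betaAbs_le hβ0 hδ₁.le hδ₁' hκ0.le hκδ hn
  have hprof := BoundaryLayer.airyProfile_eq hβ0 hα
  have hsign := BoundaryLayer.layerSign_eq n α
  have hsmul := BoundaryLayer.layerSign_mul n α
  have hfac := BoundaryLayer.norm_normFactor_le n α
  have hφ1 := BoundaryLayer.norm_normFactor_mul_le n α
  set β := BoundaryLayer.betaAbs n α
  set s := BoundaryLayer.layerSign n α
  set δ := |(n : ℝ)| / β
  set c := BoundaryLayer.normFactor n α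
  have hδ0 : 0 ≤ δ := by positivity
  have hs2 : s ^ 2 = 1 := by rcases hsign with h | h <;> rw [h] <;> norm_num
  have hδβ : δ * β = |(n : ℝ)| := div_mul_cancel₀ _ hβ0.ne'
  have hn2 : (n : ℝ) ^ 2 = δ ^ 2 * β ^ 2 := by rw [← mul_pow, hδβ, sq_abs]
  have hαn : α * n = s * β ^ 3 / 2 := by
    rw [hcube]
    linear_combination -hsmul
  have hsys := BoundaryLayer.layerSystem_layer hs2 hδ0 (hδle.trans hδ₁') hfac
  have hprof0 : ‖BoundaryLayer.airyProfile n α 0‖ ≤ Real.exp 100 := by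
    have := (BoundaryLayer.layerSystem_layer hs2 hδ0 (hδle.trans hδ₁') (c := 1)
      (by simp)).boundG 0 le_rfl
    rw [hprof]
    simpa using this
  have hcK : (Real.exp 100)⁻¹ ≤ ‖c‖ := BoundaryLayer.inv_le_norm_normFactor hK1 hprof0
  set G : ℝ → ℂ := fun ρ => c * -BoundaryLayer.expTail (-δ)
    (BoundaryLayer.expTail δ (BoundaryLayer.layer s δ)) ρ
  have hGprof : ∀ ρ, G ρ = c * BoundaryLayer.airyProfile n α ρ := fun ρ => by rw [hprof ρ]
  refine ⟨fun r => G (β * (r - 1)), _, G,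
    (BoundaryLayer.contDiff_comp_scaled hsys.smoothG).contDiffOn,
    (hsys.contDiffOn_forcing hβ).mono fun r hr => mem_Ioi.2 (zero_lt_one.trans_le hr),
    hsys.smoothG.contDiffOn, fun r hr => hsys.opA_opH_stream hβ hn2 hαn hr,
    hsys.memL2_forcing hβ, hsys.normL2_forcing_le hβ, ?_, ?_, fun r _ => rfl,
    fun ρ _ => hGprof ρ,
    fun k hk ρ hρ => hsys.exp_mul_norm_iteratedDerivWithin_le hk (zero_le_one.trans hρ)⟩
  · beta_reduce
    rw [sub_self, mul_zero, hGprof]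
    exact hφ1
  · have hd := (BoundaryLayer.hasDerivAt_comp_scaled (β := β) (r := 1)
      (hsys.derivG (β * (1 - 1)))).hasDerivWithinAt.derivWithin
        (uniqueDiffOn_Ici (1 : ℝ) 1 self_mem_Ici)
    -- the factorisation `φ' + |n| φ = β F` at the boundary
    have heq : derivWithin (fun r => G (β * (r - 1))) (Ici 1) 1 +
        ((|(n : ℝ)| : ℝ) : ℂ) * G (β * (1 - 1)) =
        β * (c * BoundaryLayer.expTail δ (BoundaryLayer.layer s δ) 0) := by
      rw [hd, ← hδβ, sub_self, mul_zero]
      push_cast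
      ring
    rw [heq, norm_mul, norm_mul, BoundaryLayer.norm_ofReal_of_nonneg hβ0.le, mul_comm]
    refine mul_le_mul_of_nonneg_left ?_ hβ0.le
    calc κ / 2 ≤ κ := by linarith
      _ ≤ (Real.exp 100)⁻¹ * L := by rw [mul_comm]; exact hκL
      _ ≤ _ := mul_le_mul hcK (hlow s δ hsign hδ0 hδle) hL.le (norm_nonneg _)
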